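/- Setting. Let $d\ge 2$, let $O\subseteq\mathbb R^d$ be open and non-empty, let $D\subseteq\partial O$ be closed (possibly empty), and let $\Sigma\subseteq\overline O\setminus D$ be a non-empty Borel set of Lebesgue measure zero carrying a Radon measure $m$. Let $V=\mathrm W^{1,2}_D(O)$ be the closure, in the norm $(\|u\|_2^2+\|\nabla u\|_2^2)^{1/2}$, of the restrictions to $O$ of the complex-valued functions in $\mathrm C_c^\infty(\mathbb R^d)$ whose support avoids $D$. Assume that the trace $u\mapsto u|_\Sigma$, defined by pointwise restriction on $V\cap \mathrm C(\overline O)$, extends to a bounded linear operator $\operatorname{tr}\colon V\to \mathrm L^2(\Sigma,m)$. For $1\le q\le\infty$ put $\mathbb L^q=\mathrm L^q(O,\mathrm dx)\oplus \mathrm L^q(\Sigma,m)=\mathrm L^q(O\cup\Sigma,\mathrm dx\oplus\mathrm dm)$ and let $j\colon V\to\mathbb L^2$, $j(u)=u\oplus\operatorname{tr}(u)$. Let $A\colon O\to\mathbb C^{d\times d}$ be bounded, measurable and uniformly strongly elliptic, that is, $\operatorname{ess\,inf}_{x\in O}\min_{|\xi|=1}\operatorname{Re}(A(x)\xi\cdot\overline\xi)>0$,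 and put $a(u,v)=\int_O A\nabla u\cdot\overline{\nabla v}\,\mathrm dx$ for $u,v\in V$. Let $\mathscr L^A$ be the operator in $\mathbb L^2$ for which $u\in\mathrm D(\mathscr L^A)$ and $\mathscr L^Au=f$ if and only if there is $w\in V$ with $j(w)=u$ and $\langle f,j(v)\rangle=a(w,v)$ for all $v\in V$. Statement. There is exactly one strongly continuous semigroup $(\mathrm e^{-t\mathscr L^A})_{t\ge0}$ on $\mathbb L^2$ with generator $-\mathscr L^A$, and for every $q\in[2,\infty)$ the following assertions are equivalent. (i) The semigroup is $\mathbb L^q$-contractive, that is, $\|\mathrm e^{-t\mathscr L^A}f\|_q\le\|f\|_q$ for all $t\ge0$ and $f\in\mathbb L^q\cap\mathbb L^2$. (ii) $\operatorname{Re}a\big(u|_O,(|u|^{q-2}u)|_O\big)\ge0$ for all $u\in j(V)$ with $|u|^{q-2}u\in j(V)$. -/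

import Mathlib

open MeasureTheory Filter Topology
open scoped ENNReal NNReal ContDiff Matrix

noncomputable section

namespace DynBC

/-! ### The Sobolev space `V = W^{1,2}_D(O)` -/

/-- `ℝ^d` with its Euclidean norm. -/
abbrev E (d : ℕ) : Type := EuclideanSpace ℝ (Fin d)

/-- `ℂ^d` with its Euclidean norm. -/
abbrev F (d : ℕ) : Type := EuclideanSpace ℂ (Fin d)

/-- The Hilbert space `L²(O) ⊕ L²(O; ℂ^d)`, whose norm is `(‖u‖₂² + ‖G‖₂²)^{1/2}`. A function `u`
in the Sobolev space is recorded, together with its weak gradient, as the pair `(u, ∇u)`, so that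
this norm is the norm of `W^{1,2}(O)`. -/
abbrev GraphSpace {d : ℕ} (O : Set (E d)) : Type :=
  WithLp 2 (Lp ℂ 2 (volume.restrict O) × Lp (F d) 2 (volume.restrict O))

/-- Complex-valued, smooth, compactly supported functions on `ℝ^d` whose support avoids `D`. -/
structure IsTest {d : ℕ} (D : Set (E d)) (φ : E d → ℂ) : Prop where
  smooth : ContDiff ℝ ∞ φ
  compact : HasCompactSupport φ
  avoids : Disjoint (tsupport φ) D

/-- The classical gradient `(∂₁φ(x), …, ∂_dφ(x)) ∈ ℂ^d`. -/
def grad {d : ℕ} (φ : E d → ℂ) (x : E d) : F d :=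
  WithLp.toLp 2 fun i => fderiv ℝ φ x (EuclideanSpace.single i 1)

/-- The pairs `(φ|_O, ∇φ|_O)` with `φ` a test function whose support avoids `D`. -/
def testPairs {d : ℕ} (O D : Set (E d)) : Submodule ℂ (GraphSpace O) where
  carrier := {p | ∃ φ : E d → ℂ, IsTest D φ ∧
    (p.fst : E d → ℂ) =ᵐ[volume.restrict O] φ ∧
    (p.snd : E d → F d) =ᵐ[volume.restrict O] grad φ}
  zero_mem' := by
    refine ⟨0, ⟨contDiff_const, HasCompactSupport.zero, by simp [tsupport]⟩, ?_, ?_⟩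
    · exact Lp.coeFn_zero _ _ _
    · refine (Lp.coeFn_zero _ _ _).trans (Eventually.of_forall fun x => ?_)
      ext i
      simp [grad]
  add_mem' := by
    rintro p r ⟨φ, hφ, h1, h2⟩ ⟨ψ, hψ, k1, k2⟩
    refine ⟨φ + ψ, ⟨hφ.smooth.add hψ.smooth, hφ.compact.add hψ.compact, ?_⟩, ?_, ?_⟩
    · exact (Disjoint.union_left hφ.avoids hψ.avoids).mono_left (tsupport_add φ ψ)
    · refine (Lp.coeFn_add p.fst r.fst).trans ?_
      exact h1.add k1
    · refine (Lp.coeFn_add p.snd r.snd).trans ?_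
      filter_upwards [h2, k2] with x hx kx
      ext i
      have e : fderiv ℝ (φ + ψ) x = fderiv ℝ φ x + fderiv ℝ ψ x :=
        fderiv_add (hφ.smooth.differentiable (by simp) x) (hψ.smooth.differentiable (by simp) x)
      simp [hx, kx, grad, e]
  smul_mem' := by
    rintro c p ⟨φ, hφ, h1, h2⟩
    refine ⟨c • φ, ⟨contDiff_const.smul hφ.smooth, hφ.compact.smul_left, ?_⟩, ?_, ?_⟩
    · exact hφ.avoids.mono_left (closure_mono (Function.support_const_smul_subset c φ))
    · refine (Lp.coeFn_smul c p.fst).trans ?_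
      exact h1.const_smul c
    · refine (Lp.coeFn_smul c p.snd).trans ?_
      filter_upwards [h2] with x hx
      ext i
      have e : fderiv ℝ (c • φ) x = c • fderiv ℝ φ x :=
        fderiv_const_smul (hφ.smooth.differentiable (by simp) x) c
      simp [hx, grad, e]

/-- `V = W^{1,2}_D(O)`: the closure, in the norm of `W^{1,2}(O)`, of the restrictions to `O` of
the test functions whose support avoids `D`. For an element `w` of `V`, `w.1.fst` is the function
and `w.1.snd` its weak gradient; as `O` is open, the former determines the latter. -/
def V {d : ℕ} (O D : Set (E d)) : Submodule ℂ (GraphSpace O) :=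
  (testPairs O D).topologicalClosure

/-- `tr` is the trace to `S`: the bounded operator `V → L²(S, m)` which is given by pointwise
restriction to `S` on all elements of `V` that are continuous on the closure of `O`. As such
elements are dense in `V`, there is at most one such operator. -/
def IsTrace {d : ℕ} {O D S : Set (E d)} {m : Measure S} (tr : V O D →L[ℂ] Lp ℂ 2 m) : Prop :=
  ∀ (w : V O D) (f : E d → ℂ), ContinuousOn f (closure O) →
    (w.1.fst : E d → ℂ) =ᵐ[volume.restrict O] f →
    (tr w : S → ℂ) =ᵐ[m] fun x => f x

/-! ### The hybrid Lebesgue spaces and the identification operator -/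

/-- `𝕃² = L²(O) ⊕ L²(S, m)`, with the inner product of `L²(O ∪ S, dx ⊕ dm)`. -/
abbrev HybridL2 {d : ℕ} (O : Set (E d)) {S : Set (E d)} (m : Measure S) : Type :=
  WithLp 2 (Lp ℂ 2 (volume.restrict O) × Lp ℂ 2 m)

/-- The norm of `𝕃^q = L^q(O ∪ S, dx ⊕ dm)`, with value `∞` on elements of `𝕃²` outside `𝕃^q`. -/
def hybridNorm {d : ℕ} {O S : Set (E d)} {m : Measure S} (q : ℝ) (f : HybridL2 O m) : ℝ≥0∞ :=
  ((∫⁻ x in O, ‖f.fst x‖ₑ ^ q) + ∫⁻ x, ‖f.snd x‖ₑ ^ q ∂m) ^ (1 / q)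

/-- The identification operator `j(u) = u|_O ⊕ tr(u)`. -/
def j {d : ℕ} {O D S : Set (E d)} {m : Measure S} (tr : V O D →L[ℂ] Lp ℂ 2 m) (w : V O D) :
    HybridL2 O m :=
  WithLp.toLp 2 (w.1.fst, tr w)

/-- `v = |u|^{q-2} u` almost everywhere on the hybrid measure space. -/
def IsPower {d : ℕ} {O S : Set (E d)} {m : Measure S} (q : ℝ) (u v : HybridL2 O m) : Prop :=
  ((v.fst : E d → ℂ) =ᵐ[volume.restrict O] fun x => ((‖u.fst x‖ ^ (q - 2) : ℝ) : ℂ) * u.fst x) ∧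
  ((v.snd : S → ℂ) =ᵐ[m] fun x => ((‖u.snd x‖ ^ (q - 2) : ℝ) : ℂ) * u.snd x)

/-! ### The form, the operator and its semigroup -/

/-- Uniformly strongly elliptic coefficients on `O` with bounded measurable complex entries. -/
structure IsElliptic {d : ℕ} (O : Set (E d)) (A : E d → Matrix (Fin d) (Fin d) ℂ) : Prop where
  measurable : ∀ i k, AEMeasurable (fun x => A x i k) (volume.restrict O)
  bounded : ∃ Λ : ℝ, ∀ᵐ x ∂(volume.restrict O), ∀ i k, ‖A x i k‖ ≤ Λ
  elliptic : ∃ l : ℝ, 0 < l ∧ ∀ᵐ x ∂(volume.restrict O), ∀ ξ : F d, ‖ξ‖ = 1 →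
    l ≤ (∑ i, (A x *ᵥ ξ.ofLp) i * star (ξ i)).re

/-- The sesquilinear form `a(u, v) = ∫_O A ∇u · conj(∇v) dx` on `V`. -/
def form {d : ℕ} {O D : Set (E d)} (A : E d → Matrix (Fin d) (Fin d) ℂ) (u v : V O D) : ℂ :=
  ∫ x in O, ∑ i, (A x *ᵥ (u.1.snd x).ofLp) i * star (v.1.snd x i)

/-- The graph of the operator `𝓛^A` in `𝕃²`: `u` lies in the domain and `𝓛^A u = f` iff there is
`w ∈ V` with `j(w) = u` and `⟨f, j(v)⟩ = a(w, v)` for all `v ∈ V`. (The pairing that is linear in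
`f` is written `inner ℂ (j v) f`.) -/
def opGraph {d : ℕ} {O D S : Set (E d)} {m : Measure S} (tr : V O D →L[ℂ] Lp ℂ 2 m)
    (A : E d → Matrix (Fin d) (Fin d) ℂ) : Set (HybridL2 O m × HybridL2 O m) :=
  {p | ∃ w : V O D, j tr w = p.1 ∧ ∀ v : V O D, inner ℂ (j tr v) p.2 = form A w v}

/-- `T` is a strongly continuous semigroup whose generator is `-L`, for an operator `L` given by
its graph: `u` is in the domain of `L` with `L u = f` iff `(u - T(t)u)/t → f` as `t ↓ 0`. -/
structure IsSemigroupOf {H : Type*} [NormedAddCommGroup H] [NormedSpace ℂ H]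
    (L : Set (H × H)) (T : ℝ≥0 → H →L[ℂ] H) : Prop where
  zero : T 0 = ContinuousLinearMap.id ℂ H
  add : ∀ s t, T (s + t) = (T s).comp (T t)
  continuous : ∀ u, Continuous fun t => T t u
  generator : ∀ u f, (u, f) ∈ L ↔
    Tendsto (fun t : ℝ≥0 => ((t : ℝ)⁻¹ : ℝ) • (u - T t u)) (𝓝[>] 0) (𝓝 f)

/-- `‖T(t) f‖_q ≤ ‖f‖_q` for all `t ≥ 0` and `f ∈ 𝕃^q ∩ 𝕃²`. -/
def IsContractive {d : ℕ} {O S : Set (E d)} {m : Measure S} (q : ℝ)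
    (T : ℝ≥0 → HybridL2 O m →L[ℂ] HybridL2 O m) : Prop :=
  ∀ (t : ℝ≥0) (f : HybridL2 O m), hybridNorm q f ≠ ⊤ → hybridNorm q (T t f) ≤ hybridNorm q f

end DynBC

end

/-! Ellipticity of `A` makes the form bounded, accretive and coercive on `V` up to the term
`‖j(w)‖²`, and `j` is injective with dense range. By Lax–Milgram `𝓛^A` is m-accretive. The semigroup
is the strong limit of the exponentials of `-r(1 - J_r)`, where `J_r = r(r + 𝓛^A)⁻¹`, and an energy
argument gives uniqueness.

(ii) ⇒ (i). Balls of `𝕃^q` are closed and convex in `𝕃²`, and the Yosida exponentials are Poisson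
averages of the powers of `J_r`, so contractivity of `J_r` on `𝕃^q` suffices. Let `j(w) = J_r f`.
The natural test function `|j(w)|^{q-2} j(w)` need not lie in `j(V)`. Instead `w` is split as `w' +
s v` with `j(v) = |j(w')|^{q-2} j(w')` (`exists_isPower_resolvent`): pointwise, `w'` is the
resolvent of the monotone map `z ↦ |z|^{q-2} z`, a normal contraction of `ℂ`, and `j(V)` is stable
under normal contractions (`exists_j_eq_compLp`). Testing with `v` and applying (ii) to the pair
`(w', v)` gives `‖j(w')‖_q^q ≤ Re⟨f, j(v)⟩`, hence `‖j(w')‖_q ≤ ‖f‖_q` by Young's inequality. As `s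
→ 0`, `j(w') → j(w)` in `𝕃²`, and Fatou's lemma concludes (`hybridPower_resolvent_le`).

(i) ⇒ (ii). For `u = j(w)` and `j(v) = |u|^{q-2} u`, contractivity and Young's inequality give
`Re⟨T_t u, j(v)⟩ ≤ ‖u‖_q^q = Re⟨u, j(v)⟩`. Laplace transformation carries this over to `J_r`
(`re_inner_resolvent_le`). With `j(w_r) = J_r u` this says `Re a(w_r, v) = r Re⟨u - J_r u, j(v)⟩ ≥
0`, and `w_r → w` weakly in `V` along `r → ∞` (`re_inner_nonneg`). -/

noncomputable section

namespace DynBC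

/-! ### M-accretive relations and their resolvents -/

section Accretive

variable {H : Type*} [NormedAddCommGroup H] [InnerProductSpace ℂ H]

theorem re_inner_real_smul_right (r : ℝ) (x y : H) :
    (inner ℂ x (r • y)).re = r * (inner ℂ x y).re := by
  rw [← Complex.coe_smul r y, inner_smul_right]; simp

theorem re_inner_self_eq (x : H) : (inner ℂ x x).re = ‖x‖ ^ 2 := by
  rw [inner_self_eq_norm_sq_to_K]; norm_cast

theorem re_inner_le_norm_mul (x y : H) : (inner ℂ x y).re ≤ ‖x‖ * ‖y‖ :=
  (Complex.re_le_norm _).trans (norm_inner_le_norm x y)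

/-- A densely defined, m-accretive linear relation, given by its graph. -/
structure IsMAccretive (L : Submodule ℂ (H × H)) : Prop where
  accretive : ∀ p ∈ L, 0 ≤ (inner ℂ p.1 p.2).re
  range : ∀ r : ℝ, 0 < r → ∀ f : H, ∃ u, (u, r • (f - u)) ∈ L
  dense : Dense {u : H | ∃ f, (u, f) ∈ L}

/-- `J r` is the rescaled resolvent `r (r + L)⁻¹`. -/
structure IsResolvent (L : Submodule ℂ (H × H)) (J : ℝ → H →L[ℂ] H) : Prop where
  mem : ∀ r : ℝ, 0 < r → ∀ f : H, (J r f, r • (f - J r f)) ∈ L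
  norm_le : ∀ r : ℝ, 0 < r → ∀ f : H, ‖J r f‖ ≤ ‖f‖

variable {L : Submodule ℂ (H × H)} {J : ℝ → H →L[ℂ] H}

namespace IsMAccretive

/-- Accretivity applied to the difference of the two graph elements reads `-r ‖u - u'‖² ≥ 0`. -/
theorem resolvent_unique (hL : IsMAccretive L) {r : ℝ} (hr : 0 < r) {f u u' : H}
    (hu : (u, r • (f - u)) ∈ L) (hu' : (u', r • (f - u')) ∈ L) : u = u' := by
  have h := hL.accretive _ (L.sub_mem hu hu')
  have e : r • (f - u) - r • (f - u') = (-r) • (u - u') := by module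
  simp only [Prod.mk_sub_mk, e, re_inner_real_smul_right, re_inner_self_eq] at h
  have : ‖u - u'‖ ^ 2 ≤ 0 := by nlinarith
  rw [← sub_eq_zero, ← norm_eq_zero]
  exact pow_eq_zero_iff two_ne_zero |>.1 (le_antisymm this (sq_nonneg _))

theorem norm_resolvent_le (hL : IsMAccretive L) {r : ℝ} (hr : 0 < r) {f u : H}
    (hu : (u, r • (f - u)) ∈ L) : ‖u‖ ≤ ‖f‖ := by
  have h := hL.accretive _ hu
  simp only [re_inner_real_smul_right, inner_sub_right, Complex.sub_re, re_inner_self_eq] at h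
  have h1 := nonneg_of_mul_nonneg_right h hr
  have h2 := re_inner_le_norm_mul u f
  by_contra! hc
  nlinarith [norm_nonneg f]

theorem exists_resolvent (hL : IsMAccretive L) : ∃ J : ℝ → H →L[ℂ] H, IsResolvent L J := by
  have key : ∀ r : ℝ, ∃ T : H →L[ℂ] H, 0 < r → ∀ f : H, (T f, r • (f - T f)) ∈ L := by
    intro r
    by_cases hr : 0 < r
    · choose g hg using hL.range r hr
      refine ⟨LinearMap.mkContinuous ⟨⟨g, fun x y => ?_⟩, fun c x => ?_⟩ 1 fun x => ?_,
        fun _ f => hg f⟩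
      · refine hL.resolvent_unique hr (hg _) ?_
        convert L.add_mem (hg x) (hg y) using 1
        ext <;> simp only [Prod.fst_add, Prod.snd_add]
        module
      · refine hL.resolvent_unique hr (hg _) ?_
        convert L.smul_mem c (hg x) using 1
        ext <;> simp only [Prod.smul_fst, Prod.smul_snd, RingHom.id_apply]
        rw [← smul_sub, smul_comm]
      · simpa using hL.norm_resolvent_le hr (hg x)
    · exact ⟨0, fun h => absurd h hr⟩
  choose J hJ using key
  exact ⟨J, fun r hr f => hJ r hr f, fun r hr f => hL.norm_resolvent_le hr (hJ r hr f)⟩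

end IsMAccretive

namespace IsResolvent

theorem eq_of_mem (hJ : IsResolvent L J) (hL : IsMAccretive L) {r : ℝ} (hr : 0 < r) {u f : H}
    (h : (u, f) ∈ L) : J r (u + r⁻¹ • f) = u := by
  refine hL.resolvent_unique hr (hJ.mem r hr _) ?_
  convert h using 2
  rw [add_sub_cancel_left, smul_smul, mul_inv_cancel₀ hr.ne', one_smul]

/-- The bounded operator `r(1 - J r)` agrees with `J r ∘ L` on the domain. All estimates for the
Yosida approximation rest on this. -/
theorem sub_apply_eq (hJ : IsResolvent L J) (hL : IsMAccretive L) {r : ℝ} (hr : 0 < r) {u f : H}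
    (h : (u, f) ∈ L) : r • (u - J r u) = J r f := by
  have h1 := hJ.eq_of_mem hL hr h
  rw [map_add, ContinuousLinearMap.map_smul_of_tower] at h1
  nth_rewrite 1 [← h1]
  rw [add_sub_cancel_left, smul_smul, mul_inv_cancel₀ hr.ne', one_smul]

/-- On the domain the error is at most `‖f‖ / r`; density and contractivity of `J r` give the rest.
-/
theorem tendsto (hJ : IsResolvent L J) (hL : IsMAccretive L) (x : H) :
    Tendsto (fun n : ℕ => J (n + 1) x) atTop (𝓝 x) := by
  rw [Metric.tendsto_atTop]
  intro ε hε
  obtain ⟨y, hy, f, hyf⟩ := Metric.dense_iff.1 hL.dense x (ε / 3) (by positivity)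
  rw [Metric.mem_ball, dist_eq_norm] at hy
  obtain ⟨N, hN⟩ := exists_nat_gt (‖f‖ / (ε / 3))
  refine ⟨N, fun n hn => ?_⟩
  have hr : (0 : ℝ) < n + 1 := by positivity
  have h1 : ‖y - J (n + 1) y‖ < ε / 3 := by
    have := congrArg norm (hJ.sub_apply_eq hL hr hyf)
    rw [norm_smul, Real.norm_of_nonneg hr.le] at this
    have h2 := hJ.norm_le _ hr f
    rw [div_lt_iff₀ (by positivity)] at hN
    have h3 : (N : ℝ) ≤ n := by exact_mod_cast hn
    by_contra! hc
    nlinarith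
  have h2 : ‖J (n + 1) (x - y)‖ < ε / 3 := by
    refine (hJ.norm_le _ hr _).trans_lt ?_
    rwa [norm_sub_rev]
  have e : J (n + 1) x - x = J (n + 1) (x - y) - (y - J (n + 1) y) + (y - x) := by
    rw [map_sub]; abel
  rw [dist_eq_norm, e]
  have := norm_add_le (J (n + 1) (x - y) - (y - J (n + 1) y)) (y - x)
  have := norm_sub_le (J (n + 1) (x - y)) (y - J (n + 1) y)
  linarith

/-- The resolvent identity: `eq_of_mem` with parameter `r`, applied to the graph element that
defines `J s f`. -/
theorem identity (hJ : IsResolvent L J) (hL : IsMAccretive L) {r s : ℝ} (hr : 0 < r)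
    (hs : 0 < s) (f : H) : (r - s) • J r (J s f) = r • J s f - s • J r f := by
  have h := hJ.eq_of_mem hL hr (hJ.mem s hs f)
  rw [map_add, ContinuousLinearMap.map_smul_of_tower, ContinuousLinearMap.map_smul_of_tower, map_sub] at h
  have h2 := congrArg (fun x => r • x) h
  simp only [smul_add, smul_smul, mul_inv_cancel_left₀ hr.ne', smul_sub] at h2
  rw [← h2]
  module

theorem commute (hJ : IsResolvent L J) (hL : IsMAccretive L) {r s : ℝ} (hr : 0 < r)
    (hs : 0 < s) : Commute (J r) (J s) := by
  rcases eq_or_ne r s with rfl | hrs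
  · exact Commute.refl _
  · ext f
    have h1 := hJ.identity hL hr hs f
    have h2 := hJ.identity hL hs hr f
    have h3 : (r - s) • (J r (J s f) - J s (J r f)) = 0 := by
      have : (r - s) • J s (J r f) = -((s - r) • J s (J r f)) := by module
      rw [smul_sub, h1, this, h2]; abel
    rcases smul_eq_zero.1 h3 with h | h
    · exact absurd (sub_eq_zero.1 h) hrs
    · exact sub_eq_zero.1 h

end IsResolvent

end Accretive

/-! ### Exponentials of `c(T - 1)` for a contraction `T` -/

section Exponential

variable {H : Type*} [NormedAddCommGroup H] [NormedSpace ℂ H] [CompleteSpace H]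

/-- Partial sums, divided by their total weight, are centres of mass in `K`. The weight tends to
`1`, and `0 < p 0` keeps it nonzero from the first term on. -/
theorem _root_.Convex.hasSum_mem {X : Type*} [NormedAddCommGroup X] [NormedSpace ℝ X] {K : Set X}
    (hK : Convex ℝ K) (hKc : IsClosed K) {p : ℕ → ℝ} {x : ℕ → X} {y : X} (hp : ∀ k, 0 ≤ p k)
    (hp0 : 0 < p 0) (hp1 : HasSum p 1) (hx : ∀ k, x k ∈ K) (hy : HasSum (fun k => p k • x k) y) :
    y ∈ K := by
  have h1 := hp1.tendsto_sum_nat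
  have h2 := hy.tendsto_sum_nat
  have h3 := (h1.inv₀ one_ne_zero).smul h2
  rw [inv_one, one_smul] at h3
  refine hKc.mem_of_tendsto h3 ?_
  filter_upwards [eventually_ge_atTop 1] with n hn
  refine hK.centerMass_mem (fun i _ => hp i) ?_ fun i _ => hx i
  exact Finset.sum_pos' (fun i _ => hp i) ⟨0, Finset.mem_range.2 hn, hp0⟩

/-- Expanding `exp(c(T - 1)) = e^{-c} exp(cT)` exhibits the value at `f` as the average of the `T^k
f` under the Poisson distribution with parameter `c`. -/
theorem exp_smul_sub_one_mem {K : Set H} (hK : Convex ℝ K) (hKc : IsClosed K) {T : H →L[ℂ] H}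
    (hT : ∀ f ∈ K, T f ∈ K) {c : ℝ} (hc : 0 ≤ c) {f : H} (hf : f ∈ K) :
    NormedSpace.exp (c • (T - 1)) f ∈ K := by
  let _ : NormedAlgebra ℚ (H →L[ℂ] H) := NormedAlgebra.restrictScalars ℚ ℝ _
  have e : NormedSpace.exp (c • (T - 1)) = Real.exp (-c) • NormedSpace.exp (c • T) := by
    have : c • (T - 1) = (-c) • (1 : H →L[ℂ] H) + c • T := by module
    rw [this, NormedSpace.exp_add_of_commute, Real.exp_eq_exp_ℝ]
    · have := (NormedSpace.algebraMap_exp_comm (𝔸 := H →L[ℂ] H) (-c)).symm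
      rw [Algebra.algebraMap_eq_smul_one, Algebra.algebraMap_eq_smul_one] at this
      rw [this, smul_one_mul]
    · exact ((Commute.one_left T).smul_left _).smul_right _
  have h1 := NormedSpace.exp_series_hasSum_exp' (𝕂 := ℝ) (c • T)
  have h2 : HasSum (fun k : ℕ => (Real.exp (-c) * ((k.factorial : ℝ)⁻¹ * c ^ k)) • (T ^ k) f)
      (NormedSpace.exp (c • (T - 1)) f) := by
    rw [e]
    have := (h1.mapL (ContinuousLinearMap.apply ℂ H f)).const_smul (Real.exp (-c))
    convert this using 2 with k
    · simp [smul_pow, smul_smul]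
    · rfl
  have h3 : HasSum (fun k : ℕ => Real.exp (-c) * ((k.factorial : ℝ)⁻¹ * c ^ k)) 1 := by
    have := (NormedSpace.exp_series_hasSum_exp' (𝕂 := ℝ) c).mul_left (Real.exp (-c))
    rw [← Real.exp_eq_exp_ℝ, ← Real.exp_add, neg_add_cancel, Real.exp_zero] at this
    exact this
  refine hK.hasSum_mem hKc (fun k => by positivity) ?_ h3 (fun k => ?_) h2
  · simp [Real.exp_pos]
  · induction k with
    | zero => simpa using hf
    | succ k ih => rw [pow_succ']; exact hT _ ih

theorem norm_exp_smul_sub_one_le {T : H →L[ℂ] H} (hT : ∀ f, ‖T f‖ ≤ ‖f‖) {c : ℝ} (hc : 0 ≤ c)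
    (f : H) : ‖NormedSpace.exp (c • (T - 1)) f‖ ≤ ‖f‖ := by
  have := exp_smul_sub_one_mem (convex_closedBall (0 : H) ‖f‖) Metric.isClosed_closedBall
    (T := T) (fun g hg => by
      rw [mem_closedBall_zero_iff] at hg ⊢
      exact (hT g).trans hg) hc (f := f) (by simp)
  simpa using this

theorem hasDerivAt_exp_smul_apply (B : H →L[ℂ] H) (u : H) (t : ℝ) :
    HasDerivAt (fun s : ℝ => NormedSpace.exp (s • B) u) (NormedSpace.exp (t • B) (B u)) t := by
  have h := hasDerivAt_exp_smul_const (𝕂 := ℝ) B t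
  exact ((ContinuousLinearMap.apply ℂ H u).restrictScalars ℝ).hasFDerivAt.comp_hasDerivAt t h

/-- The path `s ↦ exp(tC) exp(s(B - C)) u` joins the two vectors as `s` runs over `[0, t]`. By
commutation its derivative is `exp((t - s)C) exp(sB)(B - C)u`, a product of two contractions applied
to `(B - C)u`. -/
theorem norm_exp_sub_exp_le {B C : H →L[ℂ] H} (hBC : Commute B C)
    (hB : ∀ s : ℝ, 0 ≤ s → ∀ f, ‖NormedSpace.exp (s • B) f‖ ≤ ‖f‖)
    (hC : ∀ s : ℝ, 0 ≤ s → ∀ f, ‖NormedSpace.exp (s • C) f‖ ≤ ‖f‖) {t : ℝ} (ht : 0 ≤ t) (u : H) :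
    ‖NormedSpace.exp (t • B) u - NormedSpace.exp (t • C) u‖ ≤ t * ‖B u - C u‖ := by
  let _ : NormedAlgebra ℚ (H →L[ℂ] H) := NormedAlgebra.restrictScalars ℚ ℝ _
  have hD : ∀ s : ℝ, HasDerivAt (fun s : ℝ => NormedSpace.exp (t • C)
      (NormedSpace.exp (s • (B - C)) u))
      (NormedSpace.exp (t • C) (NormedSpace.exp (s • (B - C)) ((B - C) u))) s := fun s =>
    (ContinuousLinearMap.restrictScalars ℝ (NormedSpace.exp (t • C))).hasFDerivAt.comp_hasDerivAt s
      (hasDerivAt_exp_smul_apply (B - C) u s)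
  have hsplit : ∀ s : ℝ, NormedSpace.exp (t • C) * NormedSpace.exp (s • (B - C)) =
      NormedSpace.exp ((t - s) • C) * NormedSpace.exp (s • B) := by
    intro s
    rw [← NormedSpace.exp_add_of_commute, ← NormedSpace.exp_add_of_commute]
    · congr 1; module
    · exact (hBC.symm.smul_left _).smul_right _
    · exact ((hBC.symm.sub_right (Commute.refl C)).smul_left _).smul_right _
  have hb : ∀ s ∈ Set.Ico 0 t,
      ‖NormedSpace.exp (t • C) (NormedSpace.exp (s • (B - C)) ((B - C) u))‖ ≤ ‖B u - C u‖ := by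
    intro s hs
    have : NormedSpace.exp (t • C) (NormedSpace.exp (s • (B - C)) ((B - C) u)) =
        NormedSpace.exp ((t - s) • C) (NormedSpace.exp (s • B) ((B - C) u)) :=
      congrArg (fun T : H →L[ℂ] H => T ((B - C) u)) (hsplit s)
    rw [this]
    exact (hC _ (by linarith [hs.2]) _).trans (hB _ hs.1 _)
  have := norm_image_sub_le_of_norm_deriv_le_segment' (fun s _ => (hD s).hasDerivWithinAt) hb t
    ⟨ht, le_rfl⟩
  have e : NormedSpace.exp (t • C) (NormedSpace.exp (t • (B - C)) u) = NormedSpace.exp (t • B) u := by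
    have := congrArg (fun T : H →L[ℂ] H => T u) (hsplit t)
    simpa using this
  rw [e] at this
  simpa [mul_comm] using this

end Exponential

/-! ### The Yosida approximation and generation of the semigroup -/

section Generation

variable {H : Type*} [NormedAddCommGroup H] [InnerProductSpace ℂ H]
  {L : Submodule ℂ (H × H)} {J : ℝ → H →L[ℂ] H}

/-- The semigroup generated by `-r (1 - J r)`, the Yosida approximation. -/
def yosida (J : ℝ → H →L[ℂ] H) (r t : ℝ) : H →L[ℂ] H :=
  NormedSpace.exp (t • (r • (J r - 1)))

theorem yosida_zero (J : ℝ → H →L[ℂ] H) (r : ℝ) : yosida J r 0 = 1 := by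
  simp [yosida]

/-- `T t` is the strong limit of the Yosida approximations. -/
structure IsYosidaLimit (J : ℝ → H →L[ℂ] H) (T : ℝ≥0 → H →L[ℂ] H) : Prop where
  tendsto : ∀ (t : ℝ≥0) (u : H), Tendsto (fun n : ℕ => yosida J (n + 1) t u) atTop (𝓝 (T t u))

theorem IsYosidaLimit.zero {T : ℝ≥0 → H →L[ℂ] H} (hT : IsYosidaLimit J T) : T 0 = ContinuousLinearMap.id ℂ H := by
  ext u
  refine tendsto_nhds_unique (hT.tendsto 0 u) ?_
  simp [yosida_zero]

variable [CompleteSpace H]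

theorem yosida_mem {K : Set H} (hK : Convex ℝ K) (hKc : IsClosed K)
    {r : ℝ} (hr : 0 < r) (hJK : ∀ f ∈ K, J r f ∈ K) {t : ℝ} (ht : 0 ≤ t) {f : H} (hf : f ∈ K) :
    yosida J r t f ∈ K := by
  rw [yosida, smul_smul]
  exact exp_smul_sub_one_mem hK hKc hJK (by positivity) hf

theorem norm_yosida_le (hJ : IsResolvent L J) {r : ℝ} (hr : 0 < r) {t : ℝ} (ht : 0 ≤ t) (f : H) :
    ‖yosida J r t f‖ ≤ ‖f‖ := by
  rw [yosida, smul_smul]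
  exact norm_exp_smul_sub_one_le (hJ.norm_le r hr) (by positivity) f

theorem hasDerivAt_yosida (J : ℝ → H →L[ℂ] H) (r t : ℝ) (u : H) :
    HasDerivAt (fun s => yosida J r s u) (yosida J r t (r • (J r u - u))) t :=
  hasDerivAt_exp_smul_apply (r • (J r - 1)) u t

theorem yosida_add (J : ℝ → H →L[ℂ] H) (r s t : ℝ) :
    yosida J r (s + t) = yosida J r s * yosida J r t := by
  let _ : NormedAlgebra ℚ (H →L[ℂ] H) := NormedAlgebra.restrictScalars ℚ ℝ _
  rw [yosida, yosida, yosida, add_smul, NormedSpace.exp_add_of_commute]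
  exact ((Commute.refl _).smul_left _).smul_right _

theorem norm_yosida_sub_yosida_le (hL : IsMAccretive L) (hJ : IsResolvent L J) {r s : ℝ}
    (hr : 0 < r) (hs : 0 < s) {t : ℝ} (ht : 0 ≤ t) {u f : H} (h : (u, f) ∈ L) :
    ‖yosida J r t u - yosida J s t u‖ ≤ t * ‖J r f - J s f‖ := by
  have hc : Commute (r • (J r - 1)) (s • (J s - 1)) :=
    ((((hJ.commute hL hr hs).sub_left (Commute.one_left _)).sub_right
      (Commute.one_right _)).smul_left _).smul_right _
  refine (norm_exp_sub_exp_le hc (fun t ht f => norm_yosida_le hJ hr ht f)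
    (fun t ht f => norm_yosida_le hJ hs ht f) ht u).trans_eq ?_
  have e : ∀ r : ℝ, (r • (J r - 1)) u = -(r • (u - J r u)) := fun r => by
    simp [← smul_neg]
  rw [e, e, hJ.sub_apply_eq hL hr h, hJ.sub_apply_eq hL hs h, neg_sub_neg, norm_sub_rev]

theorem norm_sub_yosida_le (hL : IsMAccretive L) (hJ : IsResolvent L J) {r : ℝ}
    (hr : 0 < r) {t : ℝ} (ht : 0 ≤ t) {u f : H} (h : (u, f) ∈ L) :
    ‖yosida J r t u - u‖ ≤ t * ‖f‖ := by
  have := norm_image_sub_le_of_norm_deriv_le_segment' (a := 0) (b := t) (C := ‖f‖)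
    (fun s _ => (hasDerivAt_yosida J r s u).hasDerivWithinAt) (fun s hs => ?_) t ⟨ht, le_rfl⟩
  · simpa [yosida_zero, mul_comm] using this
  · refine (norm_yosida_le hJ hr hs.1 _).trans ?_
    have e : r • (J r u - u) = -(r • (u - J r u)) := by rw [← smul_neg, neg_sub]
    rw [e, norm_neg, hJ.sub_apply_eq hL hr h]
    exact hJ.norm_le r hr f

/-- A first-order expansion at `t = 0` with error uniform in `r`. As `f` need not lie in the domain,
a nearby `y` in the domain stands in for `J r f`; the bracket is small once `y` is close to `f`, `r`
is large and `t` is small. -/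
theorem norm_sub_yosida_sub_smul_le (hL : IsMAccretive L) (hJ : IsResolvent L J) {r : ℝ}
    (hr : 0 < r) {t : ℝ} (ht : 0 ≤ t) {u f y g : H} (h : (u, f) ∈ L) (hy : (y, g) ∈ L) :
    ‖u - yosida J r t u - t • J r f‖ ≤ t * (t * ‖g‖ + 2 * ‖J r f - y‖) := by
  have e : r • (J r u - u) = -J r f := by
    rw [← hJ.sub_apply_eq hL hr h, ← smul_neg, neg_sub]
  have hd : ∀ s : ℝ, HasDerivAt (fun s => -(yosida J r s u) - s • J r f)
      (yosida J r s (J r f) - J r f) s := by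
    intro s
    have h1 := (hasDerivAt_yosida J r s u).neg.sub ((hasDerivAt_id s).smul_const (J r f))
    rw [e, map_neg, neg_neg, one_smul] at h1
    exact h1
  have := norm_image_sub_le_of_norm_deriv_le_segment' (a := 0) (b := t)
    (C := t * ‖g‖ + 2 * ‖J r f - y‖)
    (fun s _ => (hd s).hasDerivWithinAt) (fun s hs => ?_) t ⟨ht, le_rfl⟩
  · rw [yosida_zero, zero_smul, sub_zero, sub_zero, mul_comm] at this
    convert this using 2
    simp only [one_apply_eq_self]
    abel
  · have h1 := norm_sub_yosida_le hL hJ hr hs.1 hy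
    have h2 := norm_yosida_le hJ hr hs.1 (J r f - y)
    have e2 : yosida J r s (J r f) - J r f =
        (yosida J r s y - y) + (yosida J r s (J r f - y) - (J r f - y)) := by
      rw [map_sub]; abel
    rw [e2]
    refine (norm_add_le _ _).trans ?_
    have h3 := norm_sub_le (yosida J r s (J r f - y)) (J r f - y)
    have h4 : s * ‖g‖ ≤ t * ‖g‖ := by gcongr; exact hs.2.le
    linarith

/-- On the domain the sequence is Cauchy because `J (n + 1) f` converges; density and uniform
contractivity extend this to all vectors. -/
theorem exists_isYosidaLimit (hL : IsMAccretive L) (hJ : IsResolvent L J) :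
    ∃ T : ℝ≥0 → H →L[ℂ] H, IsYosidaLimit J T := by
  have hlim : ∀ (t : ℝ≥0) (u : H), ∃ y,
      Tendsto (fun n : ℕ => yosida J (n + 1) t u) atTop (𝓝 y) := by
    intro t u
    apply cauchySeq_tendsto_of_complete
    rw [Metric.cauchySeq_iff']
    intro ε hε
    obtain ⟨y, hy, f, hyf⟩ := Metric.dense_iff.1 hL.dense u (ε / 3) (by positivity)
    rw [Metric.mem_ball, dist_eq_norm] at hy
    have hc := (hJ.tendsto hL f).cauchySeq
    obtain ⟨N, hN⟩ := Metric.cauchySeq_iff'.1 hc (ε / 3 / (t + 1)) (by positivity)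
    refine ⟨N, fun n hn => ?_⟩
    have h1 := norm_yosida_sub_yosida_le hL hJ (r := (n : ℝ) + 1) (s := (N : ℝ) + 1)
      (by positivity) (by positivity) t.coe_nonneg hyf
    have h2 := hN n hn
    rw [dist_eq_norm] at h2 ⊢
    have h3 := norm_yosida_le hJ (r := (n : ℝ) + 1) (by positivity) t.coe_nonneg (y - u)
    have h4 := norm_yosida_le hJ (r := (N : ℝ) + 1) (by positivity) t.coe_nonneg (y - u)
    have e : yosida J (n + 1) t u - yosida J (N + 1) t u =
        (yosida J (n + 1) t y - yosida J (N + 1) t y) - yosida J (n + 1) t (y - u) +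
          yosida J (N + 1) t (y - u) := by
      rw [map_sub, map_sub]; abel
    rw [e]
    have h5 : (t : ℝ) * ‖J (n + 1) f - J (N + 1) f‖ ≤ ε / 3 := by
      rw [lt_div_iff₀ (by positivity)] at h2
      nlinarith [norm_nonneg (J (n + 1) f - J (N + 1) f)]
    have h6 := norm_add_le ((yosida J (n + 1) t y - yosida J (N + 1) t y) -
      yosida J (n + 1) t (y - u)) (yosida J (N + 1) t (y - u))
    have h7 := norm_sub_le (yosida J (n + 1) t y - yosida J (N + 1) t y)
      (yosida J (n + 1) t (y - u))
    linarith [h1.trans h5]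
  choose T hT using hlim
  refine ⟨fun t => LinearMap.mkContinuous ⟨⟨T t, fun x y => ?_⟩, fun c x => ?_⟩ 1 fun x => ?_,
    ⟨hT⟩⟩
  · refine tendsto_nhds_unique (hT t _) ?_
    simpa using (hT t x).add (hT t y)
  · refine tendsto_nhds_unique (hT t _) ?_
    simpa using (hT t x).const_smul c
  · rw [one_mul]
    exact le_of_tendsto' (hT t x).norm fun n => norm_yosida_le hJ (by positivity) t.coe_nonneg x

namespace IsYosidaLimit

variable {T : ℝ≥0 → H →L[ℂ] H}

theorem norm_le (hT : IsYosidaLimit J T) (hJ : IsResolvent L J) (t : ℝ≥0) (u : H) :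
    ‖T t u‖ ≤ ‖u‖ :=
  le_of_tendsto' (hT.tendsto t u).norm fun n => norm_yosida_le hJ (by positivity) t.coe_nonneg u

theorem mem (hT : IsYosidaLimit J T) {K : Set H} (hK : Convex ℝ K)
    (hKc : IsClosed K) (hJK : ∀ r, 0 < r → ∀ f ∈ K, J r f ∈ K) (t : ℝ≥0) {f : H} (hf : f ∈ K) :
    T t f ∈ K :=
  hKc.mem_of_tendsto (hT.tendsto t f) (Eventually.of_forall fun n =>
    yosida_mem hK hKc (by positivity) (hJK _ (by positivity)) t.coe_nonneg hf)

theorem add (hT : IsYosidaLimit J T) (hJ : IsResolvent L J) (s t : ℝ≥0) :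
    T (s + t) = (T s).comp (T t) := by
  ext u
  refine tendsto_nhds_unique (hT.tendsto (s + t) u) ?_
  -- The inner limit is replaced at a cost that contractivity of the outer approximation controls
  -- uniformly in `n`.
  have h : ∀ n : ℕ, yosida J (n + 1) ((s + t : ℝ≥0) : ℝ) u =
      yosida J (n + 1) s (yosida J (n + 1) t u - T t u) + yosida J (n + 1) s (T t u) := by
    intro n
    rw [← map_add, sub_add_cancel, NNReal.coe_add, yosida_add]; rfl
  simp only [h, ContinuousLinearMap.comp_apply]
  rw [← zero_add ((T s) ((T t) u))]
  refine Tendsto.add ?_ (hT.tendsto s _)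
  refine squeeze_zero_norm (fun n => norm_yosida_le hJ (by positivity) s.coe_nonneg _) ?_
  exact tendsto_iff_norm_sub_tendsto_zero.1 (hT.tendsto t u)

theorem norm_sub_le (hT : IsYosidaLimit J T) (hL : IsMAccretive L) (hJ : IsResolvent L J)
    (t : ℝ≥0) {u f : H} (h : (u, f) ∈ L) : ‖T t u - u‖ ≤ t * ‖f‖ :=
  le_of_tendsto' ((hT.tendsto t u).sub_const u).norm fun n =>
    norm_sub_yosida_le hL hJ (by positivity) t.coe_nonneg h

/-- Orbits of domain elements are Lipschitz by the semigroup law and `norm_sub_le`; contractivity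
and density handle the other orbits. -/
theorem continuous (hT : IsYosidaLimit J T) (hL : IsMAccretive L) (hJ : IsResolvent L J) (u : H) :
    Continuous fun t => T t u := by
  have key : ∀ (s t : ℝ≥0) (x : H), s ≤ t → ‖T t x - T s x‖ ≤ ‖T (t - s) x - x‖ := by
    intro s t x hst
    have : T t x = T s (T (t - s) x) := by
      rw [← ContinuousLinearMap.comp_apply, ← hT.add hJ, add_tsub_cancel_of_le hst]
    rw [this, ← map_sub]
    exact hT.norm_le hJ s _
  rw [Metric.continuous_iff]
  intro t ε hε
  obtain ⟨y, hy, f, hyf⟩ := Metric.dense_iff.1 hL.dense u (ε / 3) (by positivity)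
  rw [Metric.mem_ball, dist_eq_norm] at hy
  have hLip : ∀ s : ℝ≥0, ‖T s y - T t y‖ ≤ dist s t * ‖f‖ := by
    intro s
    rcases le_total s t with hst | hst
    · rw [norm_sub_rev, dist_comm, NNReal.dist_eq, ← NNReal.coe_sub hst, NNReal.abs_eq]
      exact (key s t y hst).trans (hT.norm_sub_le hL hJ _ hyf)
    · rw [NNReal.dist_eq, ← NNReal.coe_sub hst, NNReal.abs_eq]
      exact (key t s y hst).trans (hT.norm_sub_le hL hJ _ hyf)
  refine ⟨ε / 3 / (‖f‖ + 1), by positivity, fun s hs => ?_⟩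
  have h1 : ‖T s y - T t y‖ ≤ ε / 3 := by
    refine (hLip s).trans ?_
    rw [lt_div_iff₀ (by positivity)] at hs
    nlinarith [dist_nonneg (x := s) (y := t)]
  have h3 := hT.norm_le hJ s (y - u)
  have h4 := hT.norm_le hJ t (y - u)
  have e : T s u - T t u = (T s y - T t y) - T s (y - u) + T t (y - u) := by
    rw [map_sub, map_sub]; abel
  rw [dist_eq_norm, e]
  have h6 := norm_add_le ((T s y - T t y) - T s (y - u)) (T t (y - u))
  have h7 := _root_.norm_sub_le (T s y - T t y) (T s (y - u))
  linarith

theorem tendsto_slope (hT : IsYosidaLimit J T) (hL : IsMAccretive L) (hJ : IsResolvent L J)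
    {u f : H} (h : (u, f) ∈ L) :
    Tendsto (fun t : ℝ≥0 => ((t : ℝ)⁻¹ : ℝ) • (u - T t u)) (𝓝[>] 0) (𝓝 f) := by
  rw [Metric.tendsto_nhdsWithin_nhds]
  intro ε hε
  obtain ⟨y, hy, g, hyg⟩ := Metric.dense_iff.1 hL.dense f (ε / 4) (by positivity)
  rw [Metric.mem_ball, dist_eq_norm, norm_sub_rev] at hy
  refine ⟨ε / 4 / (‖g‖ + 1), by positivity, fun {t} ht0 ht => ?_⟩
  have ht0' : (0 : ℝ) < t := ht0
  have hb : ‖u - T t u - (t : ℝ) • f‖ ≤ t * (t * ‖g‖ + 2 * ‖f - y‖) := by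
    refine le_of_tendsto_of_tendsto'
      ((hT.tendsto t u).const_sub u |>.sub ((hJ.tendsto hL f).const_smul (t : ℝ))).norm
      ((((hJ.tendsto hL f).sub_const y).norm.const_mul 2).const_add _ |>.const_mul _) fun n => ?_
    exact norm_sub_yosida_sub_smul_le hL hJ (by positivity) t.coe_nonneg h hyg
  have e : ((t : ℝ)⁻¹ : ℝ) • (u - T t u) - f = (t : ℝ)⁻¹ • (u - T t u - (t : ℝ) • f) := by
    rw [smul_sub _ _ ((t : ℝ) • f), smul_smul, inv_mul_cancel₀ ht0'.ne', one_smul]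
  rw [dist_eq_norm, e, norm_smul, norm_inv, Real.norm_of_nonneg ht0'.le, inv_mul_lt_iff₀ ht0']
  refine hb.trans_lt ((mul_lt_mul_iff_right₀ ht0').2 ?_)
  have h2 : (t : ℝ) * (‖g‖ + 1) < ε / 4 := by
    rw [NNReal.dist_eq, NNReal.coe_zero, sub_zero, NNReal.abs_eq, lt_div_iff₀ (by positivity)] at ht
    exact ht
  nlinarith

theorem isSemigroupOf (hT : IsYosidaLimit J T) (hL : IsMAccretive L) (hJ : IsResolvent L J) :
    IsSemigroupOf (L : Set (H × H)) T where
  zero := hT.zero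
  add := hT.add hJ
  continuous := hT.continuous hL hJ
  generator u f := by
    refine ⟨hT.tendsto_slope hL hJ, fun h => ?_⟩
    -- Maximality: `w` in the domain solves `w + L w = u + f`. The difference quotients of a
    -- contraction semigroup are accretive, which in the limit gives `-‖u - w‖² ≥ 0`, so `u = w`.
    obtain ⟨w, hw⟩ := hL.range 1 one_pos (u + f)
    have h2 := h.sub (hT.tendsto_slope hL hJ hw)
    have h3 : Tendsto (fun t : ℝ≥0 => (inner ℂ (u - w)
        (((t : ℝ)⁻¹ : ℝ) • (u - T t u) - ((t : ℝ)⁻¹ : ℝ) • (w - T t w))).re) (𝓝[>] 0)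
        (𝓝 (inner ℂ (u - w) (f - (1 : ℝ) • (u + f - w))).re) :=
      (Complex.continuous_re.tendsto _).comp (tendsto_const_nhds.inner h2)
    have h4 : 0 ≤ (inner ℂ (u - w) (f - (1 : ℝ) • (u + f - w))).re := by
      refine ge_of_tendsto' h3 fun t => ?_
      have e : ((t : ℝ)⁻¹ : ℝ) • (u - T t u) - ((t : ℝ)⁻¹ : ℝ) • (w - T t w) =
          ((t : ℝ)⁻¹ : ℝ) • ((u - w) - T t (u - w)) := by rw [map_sub]; module
      rw [e, re_inner_real_smul_right, inner_sub_right, Complex.sub_re, re_inner_self_eq]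
      have h5 := re_inner_le_norm_mul (u - w) (T t (u - w))
      have h6 := hT.norm_le hJ t (u - w)
      have : 0 ≤ ‖u - w‖ ^ 2 - (inner ℂ (u - w) (T t (u - w))).re := by
        nlinarith [norm_nonneg (u - w)]
      positivity
    have e : f - (1 : ℝ) • (u + f - w) = (-1 : ℝ) • (u - w) := by module
    rw [e, re_inner_real_smul_right, re_inner_self_eq] at h4
    have h5 : u = w := by
      rw [← sub_eq_zero, ← norm_eq_zero]
      nlinarith [sq_nonneg ‖u - w‖]
    subst h5
    simpa using hw

end IsYosidaLimit

end Generation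

/-! ### Uniqueness of the semigroup and its Laplace transform -/

section Uniqueness

variable {H : Type*} [NormedAddCommGroup H] [InnerProductSpace ℂ H]
  {L : Submodule ℂ (H × H)} {T T' : ℝ≥0 → H →L[ℂ] H}

namespace IsSemigroupOf

theorem map_mem (hT : IsSemigroupOf (L : Set (H × H)) T) (t : ℝ≥0) {u f : H} (h : (u, f) ∈ L) :
    (T t u, T t f) ∈ L := by
  refine (hT.generator _ _).2 ?_
  have h1 := ((T t).continuous.tendsto f).comp ((hT.generator _ _).1 h)
  refine h1.congr fun s => ?_
  have e : T t (T s u) = T s (T t u) := by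
    rw [← ContinuousLinearMap.comp_apply, ← ContinuousLinearMap.comp_apply, ← hT.add, ← hT.add,
      add_comm]
  simp only [Function.comp_apply, ContinuousLinearMap.map_smul_of_tower, map_sub, e]

theorem continuous_toNNReal (hT : IsSemigroupOf (L : Set (H × H)) T) (u : H) :
    Continuous fun t : ℝ => T t.toNNReal u :=
  (hT.continuous u).comp continuous_real_toNNReal

/-- The generator limit at `0` is carried to time `t` by the semigroup law. It yields a right
derivative only, which is all that the comparison arguments below use. -/
theorem hasDerivWithinAt (hT : IsSemigroupOf (L : Set (H × H)) T) {u f : H} (h : (u, f) ∈ L)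
    {t : ℝ} (ht : 0 ≤ t) :
    HasDerivWithinAt (fun s : ℝ => T s.toNNReal u) (-(T t.toNNReal f)) (Set.Ici t) t := by
  rw [hasDerivWithinAt_iff_tendsto_slope, Set.Ici_sdiff_left]
  have h1 := ((hT.generator _ _).1 (hT.map_mem t.toNNReal h)).neg
  have h2 : Tendsto (fun s : ℝ => (s - t).toNNReal) (𝓝[>] t) (𝓝[>] 0) := by
    refine tendsto_nhdsWithin_iff.2 ⟨?_, ?_⟩
    · have : Continuous fun s : ℝ => (s - t).toNNReal := by fun_prop
      simpa using (this.tendsto t).mono_left nhdsWithin_le_nhds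
    · filter_upwards [self_mem_nhdsWithin] with s hs
      simpa using hs
  refine (h1.comp h2).congr' ?_
  filter_upwards [self_mem_nhdsWithin] with s hs
  have hs' : 0 ≤ s - t := sub_nonneg.2 (le_of_lt hs)
  have e : T s.toNNReal u = T (s - t).toNNReal (T t.toNNReal u) := by
    rw [← ContinuousLinearMap.comp_apply, ← hT.add, ← Real.toNNReal_add hs' ht, sub_add_cancel]
  simp only [Function.comp_apply, slope_def_module, e, Real.coe_toNNReal _ hs']
  rw [← smul_neg, neg_sub]

/-- For `u` in the domain, `‖T s u - T' s u‖²` vanishes at `s = 0` and has nonpositive right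
derivative by accretivity of `L`. -/
theorem unique (hL : IsMAccretive L) (hT : IsSemigroupOf (L : Set (H × H)) T)
    (hT' : IsSemigroupOf (L : Set (H × H)) T') : T = T' := by
  have key : ∀ (t : ℝ≥0) (u : H), u ∈ {u : H | ∃ f, (u, f) ∈ L} → T t u = T' t u := by
    rintro t u ⟨f, h⟩
    have hd : ∀ s ∈ Set.Ico (0 : ℝ) t, HasDerivWithinAt
        (fun s : ℝ => ‖T s.toNNReal u - T' s.toNNReal u‖ ^ 2)
        (2 * (inner ℂ (T s.toNNReal u - T' s.toNNReal u)
          (-(T s.toNNReal f - T' s.toNNReal f))).re) (Set.Ici s) s := by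
      intro s hs
      have h1 := (hT.hasDerivWithinAt h hs.1).sub (hT'.hasDerivWithinAt h hs.1)
      have h2 := Complex.reCLM.hasFDerivAt.comp_hasDerivWithinAt s (h1.inner ℂ h1)
      have e : (fun s : ℝ => ‖T s.toNNReal u - T' s.toNNReal u‖ ^ 2) = Complex.reCLM ∘ fun s : ℝ =>
          inner ℂ (T s.toNNReal u - T' s.toNNReal u) (T s.toNNReal u - T' s.toNNReal u) := by
        ext s
        exact (re_inner_self_eq _).symm
      rw [e]
      refine h2.congr_deriv ?_
      simp only [Pi.sub_apply, Complex.reCLM_apply, Complex.add_re]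
      rw [← inner_conj_symm (-T s.toNNReal f - -T' s.toNNReal f), Complex.conj_re]
      have : -T s.toNNReal f - -T' s.toNNReal f = -(T s.toNNReal f - T' s.toNNReal f) := by abel
      rw [this]; ring
    have h3 := image_le_of_deriv_right_le_deriv_boundary (a := 0) (b := (t : ℝ)) (B := fun _ => 0)
      (B' := fun _ => 0) (((hT.continuous_toNNReal u).sub
      (hT'.continuous_toNNReal u)).norm.pow 2).continuousOn hd (by simp [hT.zero, hT'.zero])
      continuousOn_const (fun s _ => hasDerivWithinAt_const _ _ _) (fun s hs => ?_)
      (Set.right_mem_Icc.2 t.coe_nonneg)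
    · replace h3 : ‖T (t : ℝ).toNNReal u - T' (t : ℝ).toNNReal u‖ ^ 2 ≤ 0 := h3
      rw [Real.toNNReal_coe] at h3
      rw [← sub_eq_zero, ← norm_eq_zero]
      exact pow_eq_zero_iff two_ne_zero |>.1 (le_antisymm h3 (sq_nonneg _))
    · have := hL.accretive _ (L.sub_mem (hT.map_mem s.toNNReal h) (hT'.map_mem s.toNNReal h))
      simp only [Prod.mk_sub_mk] at this
      rw [inner_neg_right, Complex.neg_re]
      linarith
  funext t
  ext u
  exact congrFun ((T t).continuous.ext_on hL.dense (T' t).continuous fun u hu => key t u hu) u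

/-- In effect `J r f = ∫₀^∞ r e^{-rt} T_t f dt` is an average of the orbit. The integral is avoided:
with `u = J r f` and `φ t = e^{-rt} Re⟨g, T_t u⟩`, the right derivative of `-φ` is `r e^{-rt} Re⟨g,
T_t f⟩ ≤ C r e^{-rt}`. Comparison on `[0, t]` and `t → ∞` bound `φ 0`. -/
theorem re_inner_resolvent_le (hT : IsSemigroupOf (L : Set (H × H)) T)
    (hTn : ∀ t u, ‖T t u‖ ≤ ‖u‖) {J : ℝ → H →L[ℂ] H} (hJ : IsResolvent L J) {f g : H} {C : ℝ}
    (h : ∀ t, (inner ℂ g (T t f)).re ≤ C) {r : ℝ} (hr : 0 < r) : (inner ℂ g (J r f)).re ≤ C := by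
  set u := J r f with hu
  have hmem : (u, r • (f - u)) ∈ L := hJ.mem r hr f
  set φ : ℝ → ℝ := fun t => Real.exp (-r * t) * (inner ℂ g (T t.toNNReal u)).re with hφ
  have hexp : ∀ s : ℝ, HasDerivAt (fun t => Real.exp (-r * t)) (Real.exp (-r * s) * -r) s :=
    fun s => by simpa using ((hasDerivAt_id s).const_mul (-r)).exp
  have hd : ∀ s : ℝ, 0 ≤ s → HasDerivWithinAt (fun t => -φ t)
      (r * Real.exp (-r * s) * (inner ℂ g (T s.toNNReal f)).re) (Set.Ici s) s := by
    intro s hs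
    have h1 := Complex.reCLM.hasFDerivAt.comp_hasDerivWithinAt s
      ((hasDerivWithinAt_const s (Set.Ici s) g).inner ℂ (hT.hasDerivWithinAt hmem hs))
    have h2 := ((hexp s).hasDerivWithinAt (s := Set.Ici s)).mul h1 |>.neg
    refine h2.congr_deriv ?_
    simp only [Function.comp_apply, Complex.reCLM_apply, inner_zero_left, add_zero,
      inner_neg_right, Complex.neg_re, ContinuousLinearMap.map_smul_of_tower,
      re_inner_real_smul_right, map_sub, inner_sub_right, Complex.sub_re]
    ring
  have hφc : Continuous φ := by
    have := (Complex.continuous_re.comp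
      (continuous_const.inner (𝕜 := ℂ) (hT.continuous_toNNReal u) : Continuous fun t : ℝ =>
        inner ℂ g (T t.toNNReal u)))
    exact (by fun_prop : Continuous fun t : ℝ => Real.exp (-r * t)).mul this
  have hle : ∀ t : ℝ, 0 ≤ t → -φ t ≤ -φ 0 + C - C * Real.exp (-r * t) := by
    intro t ht
    refine image_le_of_deriv_right_le_deriv_boundary (a := 0) (b := t) (f := fun t => -φ t)
      (B := fun t => -φ 0 + C - C * Real.exp (-r * t))
      (B' := fun s => - (C * (Real.exp (-r * s) * -r)))
      hφc.neg.continuousOn (fun s hs => hd s hs.1) (by simp) (by fun_prop)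
      (fun s hs => ((hexp s).const_mul C |>.const_sub _).hasDerivWithinAt) (fun s hs => ?_)
      (Set.right_mem_Icc.2 ht)
    have : 0 < r * Real.exp (-r * s) := by positivity
    have := mul_le_mul_of_nonneg_left (h s.toNNReal) this.le
    linarith
  have he : Tendsto (fun t : ℝ => Real.exp (-r * t)) atTop (𝓝 0) := by
    refine Real.tendsto_exp_atBot.comp ?_
    exact tendsto_id.const_mul_atTop_of_neg (neg_neg_of_pos hr)
  have hlim : Tendsto φ atTop (𝓝 0) := by
    refine squeeze_zero_norm (a := fun t => Real.exp (-r * t) * (‖g‖ * ‖u‖)) (fun t => ?_) ?_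
    · rw [norm_mul, Real.norm_of_nonneg (Real.exp_pos _).le]
      gcongr
      refine (Complex.abs_re_le_norm _).trans ((norm_inner_le_norm _ _).trans ?_)
      gcongr
      exact hTn _ _
    · simpa using he.mul_const (‖g‖ * ‖u‖)
  have h3 := le_of_tendsto_of_tendsto hlim.neg ((he.const_mul C).const_sub (-φ 0 + C))
    (by filter_upwards [eventually_ge_atTop 0] with t ht using hle t ht)
  have h0 : φ 0 = (inner ℂ g u).re := by simp [hφ, hT.zero]
  rw [h0] at h3
  linarith

end IsSemigroupOf

end Uniqueness

/-! ### Weak compactness and Lax–Milgram -/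

section Hilbert

variable {W H : Type*} [NormedAddCommGroup W] [InnerProductSpace ℂ W]
  [NormedAddCommGroup H] [InnerProductSpace ℂ H]

theorem tendsto_inner_zero_of_dense {d : ℕ → W} {M : ℝ} (hd : ∀ n, ‖d n‖ ≤ M) {s : Set W}
    (hs : Dense s) (h : ∀ x ∈ s, Tendsto (fun n => inner ℂ x (d n)) atTop (𝓝 0)) (x : W) :
    Tendsto (fun n => inner ℂ x (d n)) atTop (𝓝 0) := by
  have hM : 0 ≤ M := (norm_nonneg _).trans (hd 0)
  rw [Metric.tendsto_atTop]
  intro ε hε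
  obtain ⟨y, hy, hys⟩ := Metric.dense_iff.1 hs x (ε / 2 / (M + 1)) (by positivity)
  obtain ⟨N, hN⟩ := Metric.tendsto_atTop.1 (h y hys) (ε / 2) (by positivity)
  refine ⟨N, fun n hn => ?_⟩
  have h1 := hN n hn
  rw [Metric.mem_ball, dist_eq_norm, norm_sub_rev, lt_div_iff₀ (by positivity)] at hy
  rw [dist_zero_right] at h1 ⊢
  have h2 := norm_inner_le_norm (𝕜 := ℂ) (x - y) (d n)
  have e : inner ℂ x (d n) = inner ℂ (x - y) (d n) + inner ℂ y (d n) := by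
    rw [inner_sub_left]; ring
  rw [e]
  have h3 := norm_add_le (inner ℂ (x - y) (d n)) (inner ℂ y (d n))
  have h4 : ‖x - y‖ * ‖d n‖ ≤ ‖x - y‖ * M := by gcongr; exact hd n
  nlinarith [norm_nonneg (x - y)]

variable [CompleteSpace W]

/-- The image of a ball of a Hilbert space under a bounded operator is closed. -/
theorem exists_map_eq_of_norm_le [CompleteSpace H] (i : W →L[ℂ] H) {y : H} {M : ℝ} {x : ℕ → W}
    (hx : ∀ n, ‖x n‖ ≤ M) (hy : Tendsto (fun n => i (x n)) atTop (𝓝 y)) : ∃ z, i z = y := by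
  let φ : ℕ → WeakDual ℂ W := fun n => StrongDual.toWeakDual (InnerProductSpace.toDual ℂ W (x n))
  have hK := WeakDual.isCompact_closedBall (𝕜 := ℂ) (E := W) 0 M
  -- A limit along an ultrafilter replaces a weakly convergent subsequence, so no separability is
  -- needed.
  obtain ⟨ℓ, -, hℓ⟩ := isCompact_iff_ultrafilter_le_nhds.1 hK
    ((hyperfilter ℕ).map φ) (by
      rw [le_principal_iff]
      have : ∀ᶠ n in (hyperfilter ℕ : Filter ℕ), φ n ∈ WeakDual.toStrongDual ⁻¹'
          Metric.closedBall (0 : StrongDual ℂ W) M := Eventually.of_forall fun n => by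
        simpa [φ] using hx n
      exact this)
  have hev : ∀ z, Tendsto (fun n => φ n z) (hyperfilter ℕ) (𝓝 (ℓ z)) := fun z =>
    ((WeakDual.eval_continuous z).tendsto ℓ).comp hℓ
  set z := (InnerProductSpace.toDual ℂ W).symm (WeakDual.toStrongDual ℓ) with hz
  have hzi : ∀ v, inner ℂ z v = ℓ v := fun v => InnerProductSpace.toDual_symm_apply
  refine ⟨z, ?_⟩
  refine ext_inner_right ℂ fun g => ?_
  rw [← ContinuousLinearMap.adjoint_inner_right, hzi]
  refine tendsto_nhds_unique (hev _)
    (((hy.mono_left Nat.hyperfilter_le_atTop).inner tendsto_const_nhds).congr fun n => ?_)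
  rw [← ContinuousLinearMap.adjoint_inner_right]
  rfl

/-- Coercivity bounds `B` from below, so its range is closed; a vector orthogonal to the range is
orthogonal to its own image and therefore zero. -/
theorem bijective_of_coercive (B : W →L[ℂ] W) {α : ℝ} (hα : 0 < α)
    (hB : ∀ w, α * ‖w‖ ^ 2 ≤ (inner ℂ w (B w)).re) : Function.Bijective B := by
  have hb : ∀ w, α * ‖w‖ ≤ ‖B w‖ := by
    intro w
    rcases eq_or_ne w 0 with rfl | hw
    · simp
    · have := (hB w).trans (re_inner_le_norm_mul w (B w))
      have h0 := norm_pos_iff.2 hw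
      nlinarith
  have hal : AntilipschitzWith (Real.toNNReal α⁻¹) B := by
    refine ContinuousLinearMap.antilipschitz_of_bound B fun w => ?_
    rw [Real.coe_toNNReal _ (by positivity), inv_mul_eq_div, le_div_iff₀ hα, mul_comm]
    exact hb w
  refine ⟨hal.injective, ?_⟩
  have hcl : IsClosed (B.range : Set W) := by
    rw [LinearMap.coe_range]
    exact hal.isClosed_range B.uniformContinuous
  have horth : B.rangeᗮ = ⊥ := by
    rw [eq_bot_iff]
    intro w hw
    have h1 := hB w
    rw [(Submodule.mem_orthogonal' _ _).1 hw (B w) ⟨w, rfl⟩] at h1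
    have : ‖w‖ ^ 2 ≤ 0 := by simp at h1; nlinarith
    have : ‖w‖ = 0 := pow_eq_zero_iff two_ne_zero |>.1 (le_antisymm this (sq_nonneg _))
    simpa using this
  have htop := (Submodule.topologicalClosure_eq_top_iff (K := B.range)).2 horth
  rw [hcl.submodule_topologicalClosure_eq] at htop
  exact LinearMap.range_eq_top.1 htop

end Hilbert

/-! ### Operators associated with elliptic forms -/

section Form

variable {W H : Type*} [NormedAddCommGroup W] [InnerProductSpace ℂ W]
  [NormedAddCommGroup H] [InnerProductSpace ℂ H]

/-- The graph of the operator associated with the form `(w, v) ↦ ⟨v, a w⟩` and the identification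
operator `i`. -/
def formRelation (i : W →L[ℂ] H) (a : W →L[ℂ] W) : Submodule ℂ (H × H) where
  carrier := {p | ∃ w, i w = p.1 ∧ ∀ v, inner ℂ (i v) p.2 = inner ℂ v (a w)}
  zero_mem' := ⟨0, by simp, by simp⟩
  add_mem' := by
    rintro p p' ⟨w, h1, h2⟩ ⟨w', h1', h2'⟩
    refine ⟨w + w', by simp [h1, h1'], fun v => ?_⟩
    simp [h2, h2']
  smul_mem' := by
    rintro c p ⟨w, h1, h2⟩
    refine ⟨c • w, by simp [h1], fun v => ?_⟩
    simp [h2]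

/-- A continuous, accretive and `i`-elliptic form `(w, v) ↦ ⟨v, a w⟩`, where `i` is injective and
has dense range. -/
structure IsEllipticForm (i : W →L[ℂ] H) (a : W →L[ℂ] W) : Prop where
  injective : Function.Injective i
  denseRange : DenseRange i
  accretive : ∀ w, 0 ≤ (inner ℂ w (a w)).re
  elliptic : ∃ α : ℝ, 0 < α ∧ ∀ w, α * ‖w‖ ^ 2 ≤ (inner ℂ w (a w)).re + ‖i w‖ ^ 2

namespace IsEllipticForm

variable {i : W →L[ℂ] H} {a : W →L[ℂ] W}

/-- The test with `v = (w - w') / s` in the resolvent equation for `w`. -/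
theorem re_inner_le_re_inner (h : IsEllipticForm i a) {r s : ℝ} (hr : 0 < r) (hs : 0 < s) {f : H}
    {w w' v : W} (hw : ∀ v, inner ℂ (i v) (r • (f - i w)) = inner ℂ v (a w))
    (hsplit : w = w' + (s : ℂ) • v) (hacc : 0 ≤ (inner ℂ v (a w')).re) :
    (inner ℂ (i v) (i w')).re ≤ (inner ℂ (i v) f).re := by
  rw [Complex.coe_smul] at hsplit
  have h1 : 0 ≤ (inner ℂ v (a w)).re := by
    rw [hsplit, map_add, ContinuousLinearMap.map_smul_of_tower, inner_add_right, Complex.add_re,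
      re_inner_real_smul_right]
    exact add_nonneg hacc (mul_nonneg hs.le (h.accretive _))
  rw [← hw v, re_inner_real_smul_right] at h1
  have h2 := nonneg_of_mul_nonneg_right h1 hr
  have h3 : i w = i w' + s • i v := by
    rw [hsplit, map_add, ContinuousLinearMap.map_smul_of_tower]
  rw [h3, inner_sub_right, inner_add_right, Complex.sub_re, Complex.add_re,
    re_inner_real_smul_right, re_inner_self_eq] at h2
  have : 0 ≤ s * ‖i v‖ ^ 2 := by positivity
  linarith

variable [CompleteSpace W] [CompleteSpace H]

/-- The operator represents the shifted form `a + r⟨i ·, i ·⟩`. Its bijectivity solves the resolvent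
equation; that of the adjoint gives density of the domain. -/
theorem bijective (h : IsEllipticForm i a) {r : ℝ} (hr : 0 < r) :
    Function.Bijective (r • (i.adjoint ∘L i) + a) ∧
      Function.Bijective (r • (i.adjoint ∘L i) + a).adjoint := by
  obtain ⟨α, hα, hel⟩ := h.elliptic
  have hc : ∀ w, min 1 r * α * ‖w‖ ^ 2 ≤
      (inner ℂ w ((r • (i.adjoint ∘L i) + a) w)).re := by
    intro w
    have h1 : (inner ℂ w ((r • (i.adjoint ∘L i) + a) w)).re =
        r * ‖i w‖ ^ 2 + (inner ℂ w (a w)).re := by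
      simp only [add_apply, smul_apply,
        ContinuousLinearMap.comp_apply, inner_add_right, Complex.add_re, re_inner_real_smul_right,
        ContinuousLinearMap.adjoint_inner_right, re_inner_self_eq]
    rw [h1]
    have h2 := mul_le_mul_of_nonneg_left (hel w) (by positivity : 0 ≤ min 1 r)
    have h3 := mul_le_mul_of_nonneg_right (min_le_left 1 r) (h.accretive w)
    have h4 := mul_le_mul_of_nonneg_right (min_le_right 1 r) (sq_nonneg ‖i w‖)
    linarith
  refine ⟨bijective_of_coercive _ (by positivity) hc,
    bijective_of_coercive _ (by positivity : 0 < min 1 r * α) fun w => ?_⟩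
  rw [ContinuousLinearMap.adjoint_inner_right, ← inner_conj_symm, Complex.conj_re]
  exact hc w

theorem isMAccretive (h : IsEllipticForm i a) : IsMAccretive (formRelation i a) where
  accretive := by
    rintro ⟨u, f⟩ ⟨w, rfl, h2⟩
    simp only [h2]
    exact h.accretive w
  range r hr f := by
    obtain ⟨w, hw⟩ := (h.bijective hr).1.2 (r • i.adjoint f)
    refine ⟨i w, w, rfl, fun v => ?_⟩
    have h1 := congrArg (fun x => inner ℂ v x) hw
    have h2 : r • (f - i w) = r • f - r • i w := smul_sub _ _ _
    have h3 : r • i.adjoint f = i.adjoint (r • f) := by rw [ContinuousLinearMap.map_smul_of_tower]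
    have h4 : r • i.adjoint (i w) = i.adjoint (r • i w) := by
      rw [ContinuousLinearMap.map_smul_of_tower]
    simp only [add_apply, smul_apply,
      ContinuousLinearMap.comp_apply, inner_add_right, h3, h4,
      ContinuousLinearMap.adjoint_inner_right] at h1
    rw [h2, inner_sub_right, ← h1]
    ring
  dense := by
    have e : {u : H | ∃ f, (u, f) ∈ formRelation i a} =
        ((formRelation i a).map (LinearMap.fst ℂ H H) : Set H) := by
      ext u; simp
    rw [e, Submodule.dense_iff_topologicalClosure_eq_top, Submodule.topologicalClosure_eq_top_iff,
      eq_bot_iff]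
    intro g hg
    rw [Submodule.mem_orthogonal'] at hg
    -- For `g` orthogonal to the domain, let `z` solve the adjoint problem with datum `g`.
    -- Orthogonality to every resolvent `i w` with datum `f` becomes `⟨i z, f⟩ = 0`, so `z = 0`, and
    -- `g` is orthogonal to the dense range of `i`.
    obtain ⟨z, hz⟩ := (h.bijective one_pos).2.2 (i.adjoint g)
    have h1 : ∀ f, inner ℂ (i z) f = 0 := by
      intro f
      obtain ⟨w, hw⟩ := (h.bijective one_pos).1.2 (i.adjoint f)
      rw [← ContinuousLinearMap.adjoint_inner_right, ← hw,
        ← ContinuousLinearMap.adjoint_inner_left, hz, ContinuousLinearMap.adjoint_inner_left]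
      refine hg (i w) ⟨(i w, f - i w), ⟨w, rfl, fun v => ?_⟩, rfl⟩
      have h2 := congrArg (fun x => inner ℂ v x) hw
      simp only [one_smul, add_apply, inner_add_right,
        ContinuousLinearMap.comp_apply, ContinuousLinearMap.adjoint_inner_right] at h2
      rw [inner_sub_right, ← h2]
      ring
    have h2 : z = 0 := h.injective (by
      rw [map_zero]; exact inner_self_eq_zero.1 (h1 (i z)))
    rw [h2, map_zero] at hz
    have h3 : ∀ y, inner ℂ g y = 0 := fun y => by
      refine congrFun (DenseRange.equalizer h.denseRange (g := fun y => inner ℂ g y) (h := fun _ => 0)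
        (by fun_prop) continuous_const (funext fun w => ?_)) y
      simp only [Function.comp_apply]
      rw [← ContinuousLinearMap.adjoint_inner_left, ← hz, inner_zero_left]
    simpa using h3 g

/-- If `Re ⟨i v, r (1 - J r) i w⟩ ≥ 0` for all `r > 0`, then `Re ⟨v, a w⟩ ≥ 0`. -/
theorem re_inner_nonneg (h : IsEllipticForm i a) {J : ℝ → H →L[ℂ] H}
    (hJ : IsResolvent (formRelation i a) J) {w v : W}
    (hv : ∀ r, 0 < r → 0 ≤ (inner ℂ (i v) (i w - J r (i w))).re) :
    0 ≤ (inner ℂ v (a w)).re := by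
  obtain ⟨α, hα, hel⟩ := h.elliptic
  have hpos : ∀ n : ℕ, (0 : ℝ) < n + 1 := fun n => by positivity
  choose x hx1 hx2 using fun n : ℕ => hJ.mem (n + 1) (hpos n) (i w)
  simp only at hx1 hx2
  -- Test the equation for `x n` with `x n - w`. As the parameter `n + 1` is at least `1`, the
  -- resulting `-(n + 1)‖i (x n - w)‖²` absorbs the term `‖i (x n - w)‖²` of the ellipticity
  -- estimate.
  have hbd : ∀ n, ‖x n - w‖ ≤ ‖a w‖ / α := by
    intro n
    have h1 := congrArg Complex.re (hx2 n (x n - w))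
    rw [re_inner_real_smul_right, ← hx1, ← map_sub, ← neg_sub (x n) w, map_neg, inner_neg_right,
      Complex.neg_re, re_inner_self_eq] at h1
    have h2 := hel (x n - w)
    rw [map_sub a, inner_sub_right, Complex.sub_re] at h2
    have h3 : -(inner ℂ (x n - w) (a w)).re ≤ ‖x n - w‖ * ‖a w‖ := by
      refine (neg_le_abs _).trans ((Complex.abs_re_le_norm _).trans (norm_inner_le_norm _ _))
    have h4 : 0 ≤ (n : ℝ) * ‖i (x n - w)‖ ^ 2 := by positivity
    have h5 : α * ‖x n - w‖ ^ 2 ≤ ‖x n - w‖ * ‖a w‖ := by nlinarith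
    rw [le_div_iff₀ hα]
    rcases (norm_nonneg (x n - w)).eq_or_lt with h0 | h0
    · rw [← h0, zero_mul]; exact norm_nonneg _
    · nlinarith
  -- Against vectors `i.adjoint g`, weak convergence in `W` is convergence of `i (x n)` in `H`,
  -- which is known. Injectivity of `i` makes these vectors dense.
  have hdense : DenseRange i.adjoint := by
    have := (Submodule.topologicalClosure_eq_top_iff (K := i.adjoint.range)).2 (by
      rw [eq_bot_iff]
      intro y hy
      rw [Submodule.mem_orthogonal'] at hy
      have : i y = 0 := by
        have := hy (i.adjoint (i y)) ⟨_, rfl⟩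
        rw [ContinuousLinearMap.adjoint_inner_right] at this
        exact inner_self_eq_zero.1 this
      simpa using h.injective (this.trans (map_zero i).symm))
    rw [← Submodule.dense_iff_topologicalClosure_eq_top] at this
    rwa [LinearMap.coe_range] at this
  have hw : Tendsto (fun n => inner ℂ (a.adjoint v) (x n - w)) atTop (𝓝 0) := by
    refine tendsto_inner_zero_of_dense hbd hdense ?_ _
    rintro _ ⟨g, rfl⟩
    simp only [ContinuousLinearMap.adjoint_inner_left, map_sub, hx1]
    have h1 := (hJ.tendsto h.isMAccretive (i w)).sub_const (i w)
    rw [sub_self] at h1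
    simpa using (tendsto_const_nhds (x := g)).inner (𝕜 := ℂ) h1
  have hw2 : Tendsto (fun n => (inner ℂ v (a (x n))).re) atTop (𝓝 (inner ℂ v (a w)).re) := by
    have h1 := (Complex.continuous_re.tendsto _).comp (hw.add_const (inner ℂ v (a w)))
    rw [zero_add] at h1
    refine h1.congr fun n => ?_
    simp only [Function.comp_apply, ContinuousLinearMap.adjoint_inner_left,
      inner_sub_right, sub_add_cancel]
  refine ge_of_tendsto' hw2 fun n => ?_
  rw [← hx2 n v, re_inner_real_smul_right]
  exact mul_nonneg (hpos n).le (hv _ (hpos n))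

end IsEllipticForm

end Form

/-! ### The power map on `ℂ` and normal contractions -/

section Scalar

/-- The map `z ↦ z + s |z|^p z` is the identity plus a monotone map, so pairing its increment with
`z - w` gives at least `‖z - w‖²`; Cauchy–Schwarz finishes. -/
theorem norm_sub_le_norm_add_smul_sub {p s : ℝ} (hp : 0 ≤ p) (hs : 0 ≤ s) (z w : ℂ) :
    ‖z - w‖ ≤ ‖(z + (s * ‖z‖ ^ p) • z) - (w + (s * ‖w‖ ^ p) • w)‖ := by
  have hmono : 0 ≤ (‖z‖ - ‖w‖) * (‖z‖ ^ p * ‖z‖ - ‖w‖ ^ p * ‖w‖) := by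
    rcases le_total ‖z‖ ‖w‖ with h | h
    · refine mul_nonneg_of_nonpos_of_nonpos (sub_nonpos.2 h) (sub_nonpos.2 ?_)
      gcongr
    · refine mul_nonneg (sub_nonneg.2 h) (sub_nonneg.2 ?_)
      gcongr
  have hzw : inner ℝ z w ≤ ‖z‖ * ‖w‖ := real_inner_le_norm z w
  have ha : 0 ≤ ‖z‖ ^ p := by positivity
  have hb : 0 ≤ ‖w‖ ^ p := by positivity
  have hinner : inner ℝ (z - w) ((z + (s * ‖z‖ ^ p) • z) - (w + (s * ‖w‖ ^ p) • w)) =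
      ‖z - w‖ ^ 2 + s * (‖z‖ ^ p * ‖z‖ ^ 2 + ‖w‖ ^ p * ‖w‖ ^ 2 -
        (‖z‖ ^ p + ‖w‖ ^ p) * inner ℝ z w) := by
    rw [← real_inner_self_eq_norm_sq, ← real_inner_self_eq_norm_sq, ← real_inner_self_eq_norm_sq]
    simp only [inner_sub_left, inner_sub_right, inner_add_right, real_inner_smul_right]
    rw [real_inner_comm w z]
    ring
  have hnn : 0 ≤ ‖z‖ ^ p * ‖z‖ ^ 2 + ‖w‖ ^ p * ‖w‖ ^ 2 -
        (‖z‖ ^ p + ‖w‖ ^ p) * inner ℝ z w := by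
    have := mul_le_mul_of_nonneg_left hzw (add_nonneg ha hb)
    nlinarith
  have hle := real_inner_le_norm (z - w) ((z + (s * ‖z‖ ^ p) • z) - (w + (s * ‖w‖ ^ p) • w))
  rw [hinner] at hle
  have hs' := mul_nonneg hs hnn
  rcases (norm_nonneg (z - w)).eq_or_lt with h0 | h0
  · rw [← h0]; exact norm_nonneg _
  · nlinarith

/-- The resolvent of the monotone map `z ↦ |z|^p z` on `ℂ` is a normal contraction. -/
theorem exists_power_resolvent {p s : ℝ} (hp : 0 ≤ p) (hs : 0 ≤ s) :
    ∃ Φ : ℂ → ℂ, (∀ z, Φ z + (s * ‖Φ z‖ ^ p) • Φ z = z) ∧ LipschitzWith 1 Φ ∧ Φ 0 = 0 := by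
  have hsurj : ∀ z : ℂ, ∃ w : ℂ, w + (s * ‖w‖ ^ p) • w = z := by
    intro z
    rcases eq_or_ne z 0 with rfl | hz
    · exact ⟨0, by simp⟩
    · have hz' := norm_pos_iff.2 hz
      -- The solution is sought on the ray through `z`; its modulus `ρ` solves a scalar equation by
      -- the intermediate value theorem.
      have hc : ContinuousOn (fun ρ : ℝ => ρ + s * ρ ^ p * ρ) (Set.Icc 0 ‖z‖) := by
        have := Real.continuous_rpow_const hp
        fun_prop
      obtain ⟨ρ, hρ, hρz⟩ := intermediate_value_Icc hz'.le hc
        (show ‖z‖ ∈ Set.Icc _ _ from ⟨by simp, by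
          have : 0 ≤ s * ‖z‖ ^ p * ‖z‖ := by positivity
          linarith⟩)
      refine ⟨(ρ / ‖z‖) • z, ?_⟩
      have hn : ‖(ρ / ‖z‖) • z‖ = ρ := by
        rw [norm_smul, Real.norm_of_nonneg (div_nonneg hρ.1 hz'.le)]
        field_simp
      rw [hn, smul_smul, ← add_smul]
      have : ρ / ‖z‖ + s * ρ ^ p * (ρ / ‖z‖) = 1 := by
        simp only at hρz
        field_simp
        linarith
      rw [this, one_smul]
  choose Φ hΦ using hsurj
  have hlip : ∀ z w, ‖Φ z - Φ w‖ ≤ ‖z - w‖ := by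
    intro z w
    have := norm_sub_le_norm_add_smul_sub hp hs (Φ z) (Φ w)
    rwa [hΦ, hΦ] at this
  refine ⟨Φ, hΦ, LipschitzWith.of_dist_le_mul fun z w => by
    simpa [dist_eq_norm] using hlip z w, ?_⟩
  have := norm_sub_le_norm_add_smul_sub hp hs (Φ 0) 0
  rw [hΦ] at this
  simpa using this

theorem tendsto_power_resolvent {p : ℝ} (hp : 0 ≤ p) {s : ℕ → ℝ} (hs : ∀ n, 0 ≤ s n)
    (hs0 : Tendsto s atTop (𝓝 0)) {z : ℂ} {w : ℕ → ℂ}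
    (hw : ∀ n, w n + (s n * ‖w n‖ ^ p) • w n = z) : Tendsto w atTop (𝓝 z) := by
  have hwz : ∀ n, ‖w n‖ ≤ ‖z‖ := by
    intro n
    have := norm_sub_le_norm_add_smul_sub hp (hs n) (w n) 0
    rw [hw] at this
    simpa using this
  rw [tendsto_iff_norm_sub_tendsto_zero]
  refine squeeze_zero (fun _ => norm_nonneg _) (g := fun n => s n * (‖z‖ ^ p * ‖z‖)) (fun n => ?_) ?_
  · have e : w n - z = -((s n * ‖w n‖ ^ p) • w n) := by
      rw [← sub_eq_zero, sub_neg_eq_add, sub_add_eq_add_sub, hw n, sub_self]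
    have h0 := hs n
    rw [e, norm_neg, norm_smul, Real.norm_of_nonneg (by positivity), mul_assoc]
    gcongr
    · exact hwz n
    · exact hwz n
  · simpa using hs0.mul_const (‖z‖ ^ p * ‖z‖)

/-- Normal contractions are uniform limits of smooth normal contractions. -/
theorem exists_contDiff_lipschitz_near {Φ : ℂ → ℂ} (hΦ : LipschitzWith 1 Φ) (h0 : Φ 0 = 0) {ε : ℝ}
    (hε : 0 < ε) : ∃ G : ℂ → ℂ, ContDiff ℝ ∞ G ∧ LipschitzWith 1 G ∧ G 0 = 0 ∧
      ∀ z, ‖G z - Φ z‖ ≤ ε := by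
  -- Mollifying at scale `ε / 2` moves `Φ` by at most `ε / 2`. Subtracting the value at `0`, to fix
  -- the origin, costs another `ε / 2`.
  let φ : ContDiffBump (0 : ℂ) := ⟨ε / 4, ε / 2, by positivity, by linarith⟩
  let G₀ : ℂ → ℂ := convolution (φ.normed volume) Φ (ContinuousLinearMap.lsmul ℝ ℝ) volume
  have hG : ∀ z, G₀ z = ∫ t, φ.normed volume t • Φ (z - t) := fun z => rfl
  have hint : ∀ z, Integrable (fun t => φ.normed volume t • Φ (z - t)) := by
    intro z
    have hc : Continuous fun t => φ.normed volume t • Φ (z - t) :=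
      φ.continuous_normed.smul (hΦ.continuous.comp (by fun_prop))
    exact hc.integrable_of_hasCompactSupport φ.hasCompactSupport_normed.smul_right
  have hsmooth : ContDiff ℝ ∞ G₀ := φ.hasCompactSupport_normed.contDiff_convolution_left _
    φ.contDiff_normed hΦ.continuous.locallyIntegrable
  have hlip : ∀ z w, ‖G₀ z - G₀ w‖ ≤ ‖z - w‖ := by
    intro z w
    rw [hG, hG, ← integral_sub (hint z) (hint w)]
    have : ‖z - w‖ = ∫ t, φ.normed volume t * ‖z - w‖ := by
      rw [integral_mul_const, φ.integral_normed, one_mul]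
    rw [this]
    refine norm_integral_le_of_norm_le
      ((φ.continuous_normed.integrable_of_hasCompactSupport
        φ.hasCompactSupport_normed).mul_const _) (Eventually.of_forall fun t => ?_)
    rw [← smul_sub, norm_smul, Real.norm_of_nonneg (φ.nonneg_normed t)]
    refine mul_le_mul_of_nonneg_left ?_ (φ.nonneg_normed t)
    have := hΦ.dist_le_mul (z - t) (w - t)
    simpa [dist_eq_norm] using this
  have hnear : ∀ z, ‖G₀ z - Φ z‖ ≤ ε / 2 := by
    intro z
    rw [← dist_eq_norm]
    refine φ.dist_normed_convolution_le hΦ.continuous.aestronglyMeasurable fun x hx => ?_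
    have h1 := hΦ.dist_le_mul x z
    rw [NNReal.coe_one, one_mul] at h1
    exact h1.trans (Metric.mem_ball.1 hx).le
  refine ⟨fun z => G₀ z - G₀ 0, hsmooth.sub contDiff_const,
    LipschitzWith.of_dist_le_mul fun z w => ?_, by simp, fun z => ?_⟩
  · simpa [dist_eq_norm] using hlip z w
  · have h1 := hnear z
    have h2 := hnear 0
    rw [h0, sub_zero] at h2
    have e : G₀ z - G₀ 0 - Φ z = (G₀ z - Φ z) - G₀ 0 := by abel
    rw [e]
    linarith [norm_sub_le (G₀ z - Φ z) (G₀ 0)]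

/-- Young's inequality with exponents `q` and `q / (q - 1)`, since `(|w|^{q-1})^{q/(q-1)} = |w|^q`.
-/
theorem re_inner_power_le {q : ℝ} (hq : 2 ≤ q) (z w : ℂ) :
    |(inner ℂ (((‖w‖ ^ (q - 2) : ℝ) : ℂ) * w) z).re| ≤
      1 / q * ‖z‖ ^ q + (1 - 1 / q) * ‖w‖ ^ q := by
  have hq0 : 0 < q := by linarith
  refine (Complex.abs_re_le_norm _).trans ((norm_inner_le_norm _ _).trans ?_)
  have hpq : q.HolderConjugate (q / (q - 1)) := Real.HolderConjugate.conjExponent (by linarith)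
  have h1 := Real.young_inequality_of_nonneg (norm_nonneg z)
    (show 0 ≤ ‖w‖ ^ (q - 2) * ‖w‖ by positivity) hpq
  have h2 : ‖w‖ ^ (q - 2) * ‖w‖ = ‖w‖ ^ (q - 1) := by
    rw [← Real.rpow_add_one' (norm_nonneg _) (by linarith)]
    congr 1; ring
  have h3 : (‖w‖ ^ (q - 1)) ^ (q / (q - 1)) = ‖w‖ ^ q := by
    rw [← Real.rpow_mul (norm_nonneg _)]
    congr 1
    have : q - 1 ≠ 0 := by linarith
    field_simp
  have h4 : ‖((‖w‖ ^ (q - 2) : ℝ) : ℂ) * w‖ = ‖w‖ ^ (q - 2) * ‖w‖ := by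
    rw [norm_mul, Complex.norm_real, Real.norm_of_nonneg (by positivity)]
  rw [h4, mul_comm]
  refine h1.trans_eq ?_
  rw [h2, h3]
  have : q - 1 ≠ 0 := by linarith
  field_simp

theorem re_inner_power_self {q : ℝ} (hq : 2 ≤ q) (w : ℂ) :
    (inner ℂ (((‖w‖ ^ (q - 2) : ℝ) : ℂ) * w) w).re = ‖w‖ ^ q := by
  have h : ((‖w‖ ^ (q - 2) : ℝ) : ℂ) * w = (‖w‖ ^ (q - 2) : ℝ) • w := (Complex.real_smul).symm
  rw [h, ← inner_conj_symm, Complex.conj_re, re_inner_real_smul_right, re_inner_self_eq]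
  rw [← Real.rpow_natCast, ← Real.rpow_add_of_nonneg (norm_nonneg _) (by linarith) (by norm_num)]
  congr 1; push_cast; ring

end Scalar

/-! ### The duality between `u` and `|u|^{q-2} u` -/

section Power

variable {α : Type*} [MeasurableSpace α] {μ : Measure α} {q : ℝ} {u v g : Lp ℂ 2 μ}

theorem toReal_lintegral_enorm_rpow (hq : 0 ≤ q) (u : Lp ℂ 2 μ) :
    (∫⁻ x, ‖u x‖ₑ ^ q ∂μ).toReal = ∫ x, ‖u x‖ ^ q ∂μ := by
  rw [integral_eq_lintegral_of_nonneg_ae (Eventually.of_forall fun x => by positivity)]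
  · congr 1
    refine lintegral_congr fun x => ?_
    rw [← ofReal_norm, ENNReal.ofReal_rpow_of_nonneg (norm_nonneg _) hq]
  · exact (Real.continuous_rpow_const hq).comp_aestronglyMeasurable
      (Lp.aestronglyMeasurable u).norm

theorem integrable_norm_rpow (hq : 0 ≤ q) (h : ∫⁻ x, ‖u x‖ₑ ^ q ∂μ ≠ ⊤) :
    Integrable (fun x => ‖u x‖ ^ q) μ := by
  refine ⟨(Real.continuous_rpow_const hq).comp_aestronglyMeasurable
      (Lp.aestronglyMeasurable u).norm, ?_⟩
  rw [hasFiniteIntegral_iff_enorm, lt_top_iff_ne_top]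
  convert h using 3 with x
  rw [← ofReal_norm, ← ofReal_norm,
    ENNReal.ofReal_rpow_of_nonneg (norm_nonneg _) hq, Real.norm_of_nonneg (by positivity)]

/-- Both `u` and `v = |u|^{q-2} u` are in `L²`, and their pointwise pairing is `|u|^q`. Thus `u`
lies in `L^q` automatically. -/
theorem integrable_norm_rpow_of_power (hq : 2 ≤ q)
    (hv : (v : α → ℂ) =ᵐ[μ] fun x => ((‖u x‖ ^ (q - 2) : ℝ) : ℂ) * u x) :
    Integrable (fun x => ‖u x‖ ^ q) μ := by
  refine (L2.integrable_inner (𝕜 := ℂ) v u).re.congr ?_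
  filter_upwards [hv] with x hx
  rw [hx]
  exact re_inner_power_self hq (u x)

theorem lintegral_ne_top_of_power (hq : 2 ≤ q)
    (hv : (v : α → ℂ) =ᵐ[μ] fun x => ((‖u x‖ ^ (q - 2) : ℝ) : ℂ) * u x) :
    ∫⁻ x, ‖u x‖ₑ ^ q ∂μ ≠ ⊤ := by
  have h := (integrable_norm_rpow_of_power hq hv).2
  rw [hasFiniteIntegral_iff_enorm, lt_top_iff_ne_top] at h
  convert h using 3 with x
  rw [← ofReal_norm, ← ofReal_norm,
    ENNReal.ofReal_rpow_of_nonneg (norm_nonneg _) (by linarith), Real.norm_of_nonneg (by positivity)]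

theorem re_inner_power_self_eq (hq : 2 ≤ q)
    (hv : (v : α → ℂ) =ᵐ[μ] fun x => ((‖u x‖ ^ (q - 2) : ℝ) : ℂ) * u x) :
    (inner ℂ v u).re = (∫⁻ x, ‖u x‖ₑ ^ q ∂μ).toReal := by
  rw [toReal_lintegral_enorm_rpow (by linarith), L2.inner_def]
  have := integral_re (L2.integrable_inner (𝕜 := ℂ) v u)
  refine this.symm.trans (integral_congr_ae ?_)
  filter_upwards [hv] with x hx
  rw [hx]
  exact re_inner_power_self hq (u x)

theorem re_inner_power_le_add (hq : 2 ≤ q)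
    (hv : (v : α → ℂ) =ᵐ[μ] fun x => ((‖u x‖ ^ (q - 2) : ℝ) : ℂ) * u x)
    (hg : ∫⁻ x, ‖g x‖ₑ ^ q ∂μ ≠ ⊤) :
    (inner ℂ v g).re ≤ 1 / q * (∫⁻ x, ‖g x‖ₑ ^ q ∂μ).toReal +
      (1 - 1 / q) * (∫⁻ x, ‖u x‖ₑ ^ q ∂μ).toReal := by
  have hq0 : 0 ≤ q := by linarith
  rw [toReal_lintegral_enorm_rpow hq0, toReal_lintegral_enorm_rpow hq0, L2.inner_def]
  refine (integral_re (L2.integrable_inner (𝕜 := ℂ) v g)).symm.trans_le ?_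
  have h1 := (integrable_norm_rpow hq0 hg).const_mul (1 / q)
  have h2 := (integrable_norm_rpow_of_power hq hv).const_mul (1 - 1 / q)
  rw [← integral_const_mul, ← integral_const_mul, ← integral_add h1 h2]
  refine integral_mono_ae (L2.integrable_inner (𝕜 := ℂ) v g).re (h1.add h2) ?_
  filter_upwards [hv] with x hx
  simp only [hx]
  exact (le_abs_self _).trans (re_inner_power_le hq (g x) (u x))

end Power

/-! ### Superposition operators on `L²` -/

section Superposition

variable {α : Type*} [MeasurableSpace α] {μ : Measure α}

theorem norm_sq_eq_integral {X : Type*} [NormedAddCommGroup X] [InnerProductSpace ℂ X]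
    (u : Lp X 2 μ) : ‖u‖ ^ 2 = ∫ x, ‖u x‖ ^ 2 ∂μ := by
  rw [← re_inner_self_eq, L2.inner_def]
  refine (integral_re (L2.integrable_inner (𝕜 := ℂ) u u)).symm.trans ?_
  exact integral_congr_ae (Eventually.of_forall fun x => re_inner_self_eq (u x))

/-- Superposition operators of normal contractions depend continuously on the contraction. -/
theorem tendsto_compLp {G : ℕ → ℂ → ℂ} {Φ : ℂ → ℂ} (hG : ∀ n, LipschitzWith 1 (G n))
    (hG0 : ∀ n, G n 0 = 0) (hΦ : LipschitzWith 1 Φ) (hΦ0 : Φ 0 = 0)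
    (hlim : ∀ z, Tendsto (fun n => G n z) atTop (𝓝 (Φ z))) {f : ℕ → Lp ℂ 2 μ} {u : Lp ℂ 2 μ}
    (hf : Tendsto f atTop (𝓝 u)) :
    Tendsto (fun n => (hG n).compLp (hG0 n) (f n)) atTop (𝓝 (hΦ.compLp hΦ0 u)) := by
  -- The operators are contractions uniformly in `n`, so it suffices to treat the fixed function
  -- `u`. There `|G n (u x) - Φ (u x)| ≤ 2 |u x|`, whence the majorant `4 |u|²`.
  have h1 : Tendsto (fun n => ‖(hG n).compLp (hG0 n) u - hΦ.compLp hΦ0 u‖) atTop (𝓝 0) := by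
    have h2 : Tendsto (fun n => ∫ x, ‖((hG n).compLp (hG0 n) u - hΦ.compLp hΦ0 u : Lp ℂ 2 μ) x‖ ^ 2
        ∂μ) atTop (𝓝 (∫ _, (0 : ℝ) ∂μ)) := by
      refine tendsto_integral_of_dominated_convergence (fun x => 4 * ‖u x‖ ^ 2)
        (fun n => (Lp.aestronglyMeasurable _).norm.pow 2)
        (((Lp.memLp u).integrable_norm_pow two_ne_zero).const_mul 4) (fun n => ?_) ?_
      · filter_upwards [Lp.coeFn_sub ((hG n).compLp (hG0 n) u) (hΦ.compLp hΦ0 u),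
          (hG n).coeFn_compLp (hG0 n) u, hΦ.coeFn_compLp hΦ0 u] with x h1 h2 h3
        rw [h1, Pi.sub_apply, h2, h3, Function.comp_apply, Function.comp_apply]
        have h4 := (hG n).dist_le_mul (u x) 0
        have h5 := hΦ.dist_le_mul (u x) 0
        rw [hG0, NNReal.coe_one, one_mul, dist_zero_right, dist_zero_right] at h4
        rw [hΦ0, NNReal.coe_one, one_mul, dist_zero_right, dist_zero_right] at h5
        have h6 := norm_sub_le (G n (u x)) (Φ (u x))
        rw [Real.norm_of_nonneg (by positivity)]
        nlinarith [norm_nonneg (G n (u x) - Φ (u x)), norm_nonneg (u x)]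
      · have hall : ∀ᵐ x ∂μ, ∀ n, ((hG n).compLp (hG0 n) u - hΦ.compLp hΦ0 u : Lp ℂ 2 μ) x =
            G n (u x) - Φ (u x) := by
          rw [ae_all_iff]
          intro n
          filter_upwards [Lp.coeFn_sub ((hG n).compLp (hG0 n) u) (hΦ.compLp hΦ0 u),
            (hG n).coeFn_compLp (hG0 n) u, hΦ.coeFn_compLp hΦ0 u] with x h1 h2 h3
          rw [h1, Pi.sub_apply, h2, h3, Function.comp_apply, Function.comp_apply]
        filter_upwards [hall] with x hx
        simp only [hx]
        have := ((hlim (u x)).sub_const (Φ (u x))).norm.pow 2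
        simpa using this
    simp only [← norm_sq_eq_integral, integral_zero] at h2
    have h3 := h2.sqrt
    simpa [Real.sqrt_sq] using h3
  rw [tendsto_iff_norm_sub_tendsto_zero]
  refine squeeze_zero (fun _ => norm_nonneg _) (g := fun n => ‖f n - u‖ +
    ‖(hG n).compLp (hG0 n) u - hΦ.compLp hΦ0 u‖) (fun n => ?_) ?_
  · have h2 := (hG n).norm_compLp_sub_le (hG0 n) (f n) u
    rw [NNReal.coe_one, one_mul] at h2
    have h3 := norm_add_le ((hG n).compLp (hG0 n) (f n) - (hG n).compLp (hG0 n) u)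
      ((hG n).compLp (hG0 n) u - hΦ.compLp hΦ0 u)
    rw [sub_add_sub_cancel] at h3
    linarith
  · simpa using (tendsto_iff_norm_sub_tendsto_zero.1 hf).add h1

end Superposition

variable {d : ℕ} {O D S : Set (E d)} {m : Measure S}

instance : CompleteSpace (V O D) :=
  inferInstanceAs (CompleteSpace (testPairs O D).topologicalClosure)

/-! ### Test functions and composition with normal contractions -/

section Test

theorem grad_eq_zero_of_notMem {φ : E d → ℂ} {x : E d} (hx : x ∉ tsupport φ) : grad φ x = 0 := by
  ext i
  simp [grad, fderiv_of_notMem_tsupport ℝ hx]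

theorem continuous_grad {φ : E d → ℂ} (hφ : ContDiff ℝ ∞ φ) : Continuous (grad φ) := by
  refine (PiLp.continuous_toLp 2 _).comp (continuous_pi fun i => ?_)
  exact (hφ.continuous_fderiv (by simp)).clm_apply continuous_const

theorem IsTest.memLp {φ : E d → ℂ} (hφ : IsTest D φ) : MemLp φ 2 (volume.restrict O) :=
  (hφ.smooth.continuous.memLp_of_hasCompactSupport hφ.compact).restrict O

theorem IsTest.memLp_grad {φ : E d → ℂ} (hφ : IsTest D φ) :
    MemLp (grad φ) 2 (volume.restrict O) :=
  ((continuous_grad hφ.smooth).memLp_of_hasCompactSupport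
    (hφ.compact.of_isClosed_subset (isClosed_tsupport _) (closure_minimal (fun x hx => by
      by_contra h
      exact hx (grad_eq_zero_of_notMem h)) (isClosed_tsupport _)))).restrict O

/-- The element of `V` given by a test function. -/
def testElement (O : Set (E d)) {φ : E d → ℂ} (hφ : IsTest D φ) : V O D :=
  ⟨WithLp.toLp 2 (hφ.memLp.toLp φ, hφ.memLp_grad.toLp (grad φ)),
    Submodule.le_topologicalClosure _ ⟨φ, hφ, hφ.memLp.coeFn_toLp, hφ.memLp_grad.coeFn_toLp⟩⟩

theorem coeFn_testElement_fst {φ : E d → ℂ} (hφ : IsTest D φ) :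
    ((testElement O hφ).1.fst : E d → ℂ) =ᵐ[volume.restrict O] φ :=
  hφ.memLp.coeFn_toLp

theorem coeFn_testElement_snd {φ : E d → ℂ} (hφ : IsTest D φ) :
    ((testElement O hφ).1.snd : E d → F d) =ᵐ[volume.restrict O] grad φ :=
  hφ.memLp_grad.coeFn_toLp

theorem coeFn_trace_testElement {tr : V O D →L[ℂ] Lp ℂ 2 m} (htr : IsTrace tr) {φ : E d → ℂ}
    (hφ : IsTest D φ) : (tr (testElement O hφ) : S → ℂ) =ᵐ[m] fun x => φ x :=
  htr _ φ hφ.smooth.continuous.continuousOn (coeFn_testElement_fst hφ)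

theorem exists_tendsto_testElement (w : V O D) : ∃ (φ : ℕ → E d → ℂ) (hφ : ∀ n, IsTest D (φ n)),
    Tendsto (fun n => testElement O (hφ n)) atTop (𝓝 w) := by
  obtain ⟨p, hp, hlim⟩ := mem_closure_iff_seq_limit.1 w.2
  choose φ hφ h1 h2 using hp
  refine ⟨φ, hφ, tendsto_subtype_rng.2 (hlim.congr fun n => ?_)⟩
  have e1 : (p n).fst = (hφ n).memLp.toLp (φ n) :=
    Lp.ext ((h1 n).trans (hφ n).memLp.coeFn_toLp.symm)
  have e2 : (p n).snd = (hφ n).memLp_grad.toLp (grad (φ n)) :=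
    Lp.ext ((h2 n).trans (hφ n).memLp_grad.coeFn_toLp.symm)
  change p n = WithLp.toLp 2 ((hφ n).memLp.toLp (φ n), (hφ n).memLp_grad.toLp (grad (φ n)))
  rw [← e1, ← e2]
  rfl

theorem IsTest.comp {φ : E d → ℂ} (hφ : IsTest D φ) {G : ℂ → ℂ} (hG : ContDiff ℝ ∞ G)
    (h0 : G 0 = 0) : IsTest D (G ∘ φ) where
  smooth := hG.comp hφ.smooth
  compact := hφ.compact.comp_left h0
  avoids := hφ.avoids.mono_left (closure_mono (Function.support_comp_subset h0 φ))

/-- The derivative of `G` is only real-linear, but each coordinate of the gradient is a real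
directional derivative, to which `‖DG‖ ≤ 1` applies separately. -/
theorem norm_grad_comp_le {φ : E d → ℂ} (hφ : ContDiff ℝ ∞ φ) {G : ℂ → ℂ} (hG : ContDiff ℝ ∞ G)
    (hlip : LipschitzWith 1 G) (x : E d) : ‖grad (G ∘ φ) x‖ ≤ ‖grad φ x‖ := by
  rw [EuclideanSpace.norm_eq, EuclideanSpace.norm_eq]
  refine Real.sqrt_le_sqrt (Finset.sum_le_sum fun i _ => ?_)
  have h1 : fderiv ℝ (G ∘ φ) x = (fderiv ℝ G (φ x)).comp (fderiv ℝ φ x) :=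
    fderiv_comp x (hG.differentiable (by simp) _) (hφ.differentiable (by simp) _)
  simp only [grad, h1, ContinuousLinearMap.comp_apply]
  have h2 : ‖fderiv ℝ G (φ x)‖ ≤ 1 := norm_fderiv_le_of_lipschitz ℝ hlip
  have h3 := (fderiv ℝ G (φ x)).le_of_opNorm_le h2 (fderiv ℝ φ x (EuclideanSpace.single i 1))
  rw [one_mul] at h3
  gcongr

theorem norm_testElement_comp_le {φ : E d → ℂ} (hφ : IsTest D φ) {G : ℂ → ℂ} (hG : ContDiff ℝ ∞ G)
    (h0 : G 0 = 0) (hlip : LipschitzWith 1 G) :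
    ‖testElement O (hφ.comp hG h0)‖ ≤ ‖testElement O hφ‖ := by
  refine le_of_sq_le_sq ?_ (norm_nonneg _)
  rw [Submodule.coe_norm, Submodule.coe_norm, WithLp.prod_norm_sq_eq_of_L2,
    WithLp.prod_norm_sq_eq_of_L2]
  gcongr
  · refine Lp.norm_le_norm_of_ae_le ?_
    filter_upwards [coeFn_testElement_fst (O := O) hφ,
      coeFn_testElement_fst (O := O) (hφ.comp hG h0)] with x h1 h2
    rw [h1, h2]
    have := hlip.dist_le_mul (φ x) 0
    simpa [h0] using this
  · refine Lp.norm_le_norm_of_ae_le ?_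
    filter_upwards [coeFn_testElement_snd (O := O) hφ,
      coeFn_testElement_snd (O := O) (hφ.comp hG h0)] with x h1 h2
    rw [h1, h2]
    exact norm_grad_comp_le hφ.smooth hG hlip x

end Test

/-! ### Invariance of `j(V)` under normal contractions -/

section Identification

/-- The identification operator as a bounded operator. -/
def jCLM (tr : V O D →L[ℂ] Lp ℂ 2 m) : V O D →L[ℂ] HybridL2 O m :=
  (WithLp.prodContinuousLinearEquiv 2 ℂ _ _).symm.toContinuousLinearMap ∘L
    ((WithLp.fstL 2 ℂ _ _ ∘L (V O D).subtypeL).prod tr)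

/-- `j(V)` is invariant under normal contractions. -/
theorem exists_j_eq_compLp {tr : V O D →L[ℂ] Lp ℂ 2 m} (htr : IsTrace tr) {Φ : ℂ → ℂ}
    (hΦ : LipschitzWith 1 Φ) (h0 : Φ 0 = 0) (w : V O D) :
    ∃ w' : V O D, j tr w' = WithLp.toLp 2 (hΦ.compLp h0 w.1.fst, hΦ.compLp h0 (tr w)) := by
  obtain ⟨φ, hφ, hlim⟩ := exists_tendsto_testElement w
  obtain ⟨M, hM⟩ := hlim.norm.bddAbove_range
  choose G hG hGl hG0 hGΦ using fun n : ℕ =>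
    exists_contDiff_lipschitz_near hΦ h0 (Nat.one_div_pos_of_nat (α := ℝ) (n := n))
  have hGlim : ∀ z, Tendsto (fun n => G n z) atTop (𝓝 (Φ z)) := fun z =>
    tendsto_iff_norm_sub_tendsto_zero.2 (squeeze_zero (fun _ => norm_nonneg _) (fun n => hGΦ n z)
      tendsto_one_div_add_atTop_nhds_zero_nat)
  -- The functions `G n ∘ φ n` are bounded in `V` by the chain rule. Strong convergence of their
  -- images in `𝕃²` then suffices; no convergence of the gradients is needed.
  refine exists_map_eq_of_norm_le (jCLM tr) (M := M)
    (x := fun n => testElement O ((hφ n).comp (hG n) (hG0 n))) (fun n =>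
      (norm_testElement_comp_le (hφ n) (hG n) (hG0 n) (hGl n)).trans (hM ⟨n, rfl⟩)) ?_
  have h1 : Tendsto (fun n => (testElement O (hφ n)).1.fst) atTop (𝓝 w.1.fst) :=
    ((WithLp.fstL 2 ℂ _ _ ∘L (V O D).subtypeL).continuous.tendsto w).comp hlim
  have h2 : Tendsto (fun n => tr (testElement O (hφ n))) atTop (𝓝 (tr w)) :=
    (tr.continuous.tendsto w).comp hlim
  have h3 := ((WithLp.prodContinuousLinearEquiv 2 ℂ (Lp ℂ 2 (volume.restrict O))
    (Lp ℂ 2 m)).symm.continuous.tendsto _).comp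
    ((tendsto_compLp hGl hG0 hΦ h0 hGlim h1).prodMk_nhds (tendsto_compLp hGl hG0 hΦ h0 hGlim h2))
  refine h3.congr fun n => ?_
  have e1 : (hGl n).compLp (hG0 n) (testElement O (hφ n)).1.fst =
      (testElement O ((hφ n).comp (hG n) (hG0 n))).1.fst := by
    refine Lp.ext ?_
    filter_upwards [(hGl n).coeFn_compLp (hG0 n) (testElement O (hφ n)).1.fst,
      coeFn_testElement_fst (O := O) (hφ n),
      coeFn_testElement_fst (O := O) ((hφ n).comp (hG n) (hG0 n))] with x k1 k2 k3
    rw [k1, k3, Function.comp_apply, k2, Function.comp_apply]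
  have e2 : (hGl n).compLp (hG0 n) (tr (testElement O (hφ n))) =
      tr (testElement O ((hφ n).comp (hG n) (hG0 n))) := by
    refine Lp.ext ?_
    filter_upwards [(hGl n).coeFn_compLp (hG0 n) (tr (testElement O (hφ n))),
      coeFn_trace_testElement htr (hφ n),
      coeFn_trace_testElement htr ((hφ n).comp (hG n) (hG0 n))] with x k1 k2 k3
    rw [k1, k3, Function.comp_apply, k2, Function.comp_apply]
  simp only [Function.comp_apply, e1, e2]
  rfl

end Identification

/-! ### The weak gradient and injectivity of `j` -/

section WeakGradient

/-- The defining identity of the weak gradient. -/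
theorem integral_smul_snd_eq_neg (w : V O D) {ψ : E d → ℝ} (hψ : ContDiff ℝ ∞ ψ)
    (hψc : HasCompactSupport ψ) (hψO : tsupport ψ ⊆ O) (i : Fin d) :
    ∫ x in O, ψ x • w.1.snd x i =
      -∫ x in O, fderiv ℝ ψ x (EuclideanSpace.single i 1) • w.1.fst x := by
  have hψ1 : MemLp (fun x => EuclideanSpace.single i (ψ x : ℂ)) 2 (volume.restrict O) := by
    refine (Continuous.memLp_of_hasCompactSupport ?_ ?_).restrict O
    · refine (PiLp.continuous_toLp 2 _).comp ?_
      exact (continuous_single i).comp (Complex.continuous_ofReal.comp hψ.continuous)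
    · exact hψc.comp_left (g := fun r : ℝ => EuclideanSpace.single i (r : ℂ)) (by simp)
  have hψ2 : MemLp (fun x => (fderiv ℝ ψ x (EuclideanSpace.single i 1) : ℂ)) 2
      (volume.restrict O) := by
    refine (Continuous.memLp_of_hasCompactSupport ?_ ?_).restrict O
    · exact Complex.continuous_ofReal.comp
        ((hψ.continuous_fderiv (by simp)).clm_apply continuous_const)
    · exact (hψc.fderiv (𝕜 := ℝ)).comp_left
        (g := fun T : E d →L[ℝ] ℝ => (T (EuclideanSpace.single i 1) : ℂ)) (by simp)
  have e1 : ∀ w : V O D, ∫ x in O, ψ x • w.1.snd x i = inner ℂ (hψ1.toLp _) w.1.snd := by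
    intro w
    rw [L2.inner_def]
    refine integral_congr_ae ?_
    filter_upwards [hψ1.coeFn_toLp] with x hx
    rw [hx, EuclideanSpace.inner_single_left]
    simp
  have e2 : ∀ w : V O D, ∫ x in O, fderiv ℝ ψ x (EuclideanSpace.single i 1) • w.1.fst x =
      inner ℂ (hψ2.toLp _) w.1.fst := by
    intro w
    rw [L2.inner_def]
    refine integral_congr_ae ?_
    filter_upwards [hψ2.coeFn_toLp] with x hx
    rw [hx]
    simp [mul_comm]
  obtain ⟨φ, hφ, hlim⟩ := exists_tendsto_testElement w
  have hfst : Continuous fun w : V O D => w.1.fst :=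
    (WithLp.fstL 2 ℂ _ _ ∘L (V O D).subtypeL).continuous
  have hsnd : Continuous fun w : V O D => w.1.snd :=
    (WithLp.sndL 2 ℂ _ _ ∘L (V O D).subtypeL).continuous
  rw [e1, e2]
  refine tendsto_nhds_unique ((tendsto_const_nhds.inner ((hsnd.tendsto w).comp hlim)))
    ((tendsto_const_nhds.inner ((hfst.tendsto w).comp hlim)).neg.congr fun n => ?_)
  simp only [Function.comp_apply]
  rw [← e1, ← e2]
  have f1 : ∫ x in O, ψ x • (testElement O (hφ n)).1.snd x i =
      ∫ x, ψ x • fderiv ℝ (φ n) x (EuclideanSpace.single i 1) := by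
    refine (integral_congr_ae ?_).trans
      (setIntegral_eq_integral_of_forall_compl_eq_zero (s := O) ?_)
    · filter_upwards [coeFn_testElement_snd (O := O) (hφ n)] with x hx
      rw [hx]; rfl
    · intro x hx
      rw [image_eq_zero_of_notMem_tsupport fun h => hx (hψO h), zero_smul]
  have f2 : ∫ x in O, fderiv ℝ ψ x (EuclideanSpace.single i 1) • (testElement O (hφ n)).1.fst x =
      ∫ x, fderiv ℝ ψ x (EuclideanSpace.single i 1) • φ n x := by
    refine (integral_congr_ae ?_).trans
      (setIntegral_eq_integral_of_forall_compl_eq_zero (s := O) ?_)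
    · filter_upwards [coeFn_testElement_fst (O := O) (hφ n)] with x hx
      rw [hx]
    · intro x hx
      rw [fderiv_of_notMem_tsupport ℝ fun h => hx (hψO h)]
      simp
  rw [f1, f2]
  have hφ' := (hφ n).smooth
  refine (integral_smul_fderiv_eq_neg_fderiv_smul_of_integrable ?_ ?_ ?_
    (fun x _ => hψ.differentiable (by simp) x) (fun x _ => hφ'.differentiable (by simp) x)).symm
  · exact (((hψ.continuous_fderiv (by simp)).clm_apply continuous_const).smul
      hφ'.continuous).integrable_of_hasCompactSupport (hφ n).compact.smul_left
  · exact (hψ.continuous.smul ((hφ'.continuous_fderiv (by simp)).clm_apply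
      continuous_const)).integrable_of_hasCompactSupport hψc.smul_right
  · exact (hψ.continuous.smul hφ'.continuous).integrable_of_hasCompactSupport hψc.smul_right

/-- If the function on `O` vanishes, integration by parts shows that its weak gradient annihilates
all test functions supported in the open set `O`. -/
theorem jCLM_injective (hO : IsOpen O) (tr : V O D →L[ℂ] Lp ℂ 2 m) :
    Function.Injective (jCLM tr) := by
  rw [injective_iff_map_eq_zero]
  intro w hw
  have h1 : w.1.fst = 0 := congrArg WithLp.fst hw
  have h2 : ∀ i, ∀ᵐ x ∂volume.restrict O, w.1.snd x i = 0 := by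
    intro i
    have hmem : MemLp (fun x => w.1.snd x i) 2 (volume.restrict O) :=
      (EuclideanSpace.proj (𝕜 := ℂ) i).comp_memLp w.1.snd
    have h3 := hO.ae_eq_zero_of_integral_contDiff_smul_eq_zero (μ := volume.restrict O)
      ((hmem.locallyIntegrable (by norm_num)).locallyIntegrableOn O) fun ψ h1' h2' h3' => by
        rw [integral_smul_snd_eq_neg w h1' h2' h3' i, h1, neg_eq_zero]
        refine (integral_congr_ae ?_).trans (integral_zero _ _)
        filter_upwards [Lp.coeFn_zero ℂ 2 (volume.restrict O)] with x hx
        rw [hx]; simp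
    filter_upwards [h3, ae_restrict_mem hO.measurableSet] with x hx hxO using hx hxO
  have h3 : w.1.snd = 0 := by
    refine Lp.ext ?_
    filter_upwards [ae_all_iff.2 h2, Lp.coeFn_zero (F d) 2 (volume.restrict O)] with x hx hx0
    rw [hx0]
    ext i
    exact hx i
  refine Subtype.ext ?_
  change w.1 = WithLp.toLp 2 (0, 0)
  rw [← h1, ← h3]
  rfl

end WeakGradient

/-! ### Density of `j(V)` in `𝕃²` -/

section Density

/-- The complexification of a real test function. -/
theorem isTest_ofReal {ψ : E d → ℝ} (hψ : ContDiff ℝ ∞ ψ) (hψc : HasCompactSupport ψ)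
    (hψD : tsupport ψ ⊆ Dᶜ) : IsTest D fun x => (ψ x : ℂ) where
  smooth := Complex.ofRealCLM.contDiff.comp hψ
  compact := hψc.comp_left Complex.ofReal_zero
  avoids := (Set.disjoint_left.2 fun _ hx => hψD hx).mono_left
    (closure_mono (Function.support_comp_subset Complex.ofReal_zero ψ))

/-- Boundedness of the trace forces the measure to be locally finite off `D`. -/
theorem exists_nhds_measure_lt_top (hD : IsClosed D) {tr : V O D →L[ℂ] Lp ℂ 2 m} (htr : IsTrace tr)
    {x : E d} (hx : x ∈ Dᶜ) : ∃ N ∈ 𝓝 x, m (Subtype.val ⁻¹' N) < ⊤ := by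
  obtain ⟨ψ, h1, h2, h3, -, h5⟩ := exists_contDiff_tsupport_subset (n := ⊤)
    (hD.isOpen_compl.mem_nhds hx)
  have hψ := isTest_ofReal h3 h2 h1
  -- The trace of the bump `ψ` is its pointwise restriction, which is therefore in `L²(m)`;
  -- Chebyshev's inequality bounds the measure of this superlevel set, a neighbourhood of `x`
  -- because `ψ x = 1`.
  refine ⟨{y | 1 / 2 ≤ ψ y}, ?_, ?_⟩
  · exact (h3.continuous.tendsto x).eventually (Ici_mem_nhds (by rw [h5]; norm_num))
  · have hmem : MemLp (fun y : S => (ψ y : ℂ)) 2 m :=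
      (memLp_congr_ae (coeFn_trace_testElement htr hψ)).1 (Lp.memLp _)
    refine (measure_mono fun y hy => ?_).trans_lt
      (hmem.meas_ge_lt_top (by simp) (by simp) (ε := 1 / 2) (by simp))
    have hy' : 1 / 2 ≤ ψ y := hy
    simp only [Set.mem_ofPred_eq]
    rw [← NNReal.coe_le_coe, coe_nnnorm, Complex.norm_real, Real.norm_eq_abs]
    push_cast
    exact hy'.trans (le_abs_self _)

/-- As `S` is null, an `h` orthogonal to the range is encoded by one function `g` on `ℝ^d`, equal to
`h.snd` on `S` and to `h.fst` almost everywhere on `O`. Orthogonality says that `g` annihilates all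
real test functions supported off `D` with respect to `dx|_O + m`. So `g = 0` almost everywhere off
`D`, and `Dᶜ` contains `O` and `S`. -/
theorem jCLM_denseRange (hO : IsOpen O) (hD : IsClosed D) (hDO : D ⊆ frontier O)
    (hS : S ⊆ closure O \ D) (hSmeas : MeasurableSet S) (hSnull : volume S = 0)
    {tr : V O D →L[ℂ] Lp ℂ 2 m} (htr : IsTrace tr) : DenseRange (jCLM tr) := by
  have hOD : O ⊆ Dᶜ := fun x hx hxD => by
    have := hDO hxD
    rw [hO.frontier_eq] at this
    exact this.2 hx
  have hSD : S ⊆ Dᶜ := fun x hx => (hS hx).2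
  suffices h : (jCLM tr).rangeᗮ = ⊥ by
    have := (Submodule.topologicalClosure_eq_top_iff (K := (jCLM tr).range)).2 h
    rwa [← Submodule.dense_iff_topologicalClosure_eq_top, LinearMap.coe_range] at this
  rw [eq_bot_iff]
  intro h hh
  rw [Submodule.mem_orthogonal] at hh
  set g : E d → ℂ := Function.extend Subtype.val (h.snd : S → ℂ) (h.fst : E d → ℂ) with hg
  have hgS : ∀ y : S, g y = h.snd y := fun y => Subtype.val_injective.extend_apply _ _ y
  have hgO : g =ᵐ[volume.restrict O] h.fst := by
    have : ∀ᵐ x ∂volume.restrict O, x ∉ S :=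
      ae_restrict_of_ae (measure_eq_zero_iff_ae_notMem.1 hSnull)
    filter_upwards [this] with x hx
    exact Function.extend_apply' _ _ _ (by rintro ⟨y, rfl⟩; exact hx y.2)
  have hemb := MeasurableEmbedding.subtype_coe hSmeas
  set μ : Measure (E d) := volume.restrict O + m.map Subtype.val with hμ
  have hloc : LocallyIntegrableOn g Dᶜ μ := by
    -- Near `x` both measures are finite, Lebesgue measure on the unit ball and `m` by boundedness
    -- of the trace, so square integrability implies integrability.
    intro x hx
    obtain ⟨N, hN, hNm⟩ := exists_nhds_measure_lt_top hD htr hx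
    obtain ⟨N', hN'N, hN'o, hxN'⟩ := mem_nhds_iff.1 hN
    refine ⟨N' ∩ Metric.ball x 1, mem_nhdsWithin_of_mem_nhds (inter_mem
      (hN'o.mem_nhds hxN') (Metric.ball_mem_nhds x one_pos)), ?_⟩
    have hms : MeasurableSet (N' ∩ Metric.ball x 1) := hN'o.measurableSet.inter measurableSet_ball
    refine IntegrableOn.add_measure ?_ ?_
    · have hfin : (volume.restrict O) (N' ∩ Metric.ball x 1) < ⊤ :=
        (measure_mono Set.inter_subset_right).trans_lt measure_ball_lt_top
      have : Fact ((volume.restrict O) (N' ∩ Metric.ball x 1) < ⊤) := ⟨hfin⟩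
      have h1 : IntegrableOn (h.fst : E d → ℂ) (N' ∩ Metric.ball x 1) (volume.restrict O) :=
        ((Lp.memLp h.fst).restrict _).integrable (by norm_num)
      exact h1.congr (ae_restrict_of_ae hgO.symm)
    · rw [hemb.integrableOn_map_iff]
      have hfin : m (Subtype.val ⁻¹' (N' ∩ Metric.ball x 1)) < ⊤ :=
        (measure_mono (Set.preimage_mono (Set.inter_subset_left.trans hN'N))).trans_lt hNm
      have : Fact (m (Subtype.val ⁻¹' (N' ∩ Metric.ball x 1)) < ⊤) := ⟨hfin⟩
      have h1 : IntegrableOn (h.snd : S → ℂ) (Subtype.val ⁻¹' (N' ∩ Metric.ball x 1)) m :=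
        ((Lp.memLp h.snd).restrict _).integrable (by norm_num)
      exact h1.congr (Eventually.of_forall fun y => (hgS y).symm)
  have hzero := hD.isOpen_compl.ae_eq_zero_of_integral_contDiff_smul_eq_zero hloc
    fun ψ h1 h2 h3 => by
      have hψ := isTest_ofReal h1 h2 h3
      have k1 := hh _ ⟨testElement O hψ, rfl⟩
      have k2 : inner ℂ (j tr (testElement O hψ)) h = 0 := k1
      rw [WithLp.prod_inner_apply] at k2
      have k3 : inner ℂ (j tr (testElement O hψ)).fst h.fst =
          ∫ x, ψ x • g x ∂volume.restrict O := by
        rw [L2.inner_def]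
        refine integral_congr_ae ?_
        filter_upwards [coeFn_testElement_fst (O := O) hψ, hgO] with x hx hx2
        rw [hx2]
        change inner ℂ ((testElement O hψ).1.fst x) _ = _
        rw [hx]
        simp [mul_comm]
      have k4 : inner ℂ (j tr (testElement O hψ)).snd h.snd =
          ∫ x, ψ x • g x ∂m.map Subtype.val := by
        rw [L2.inner_def, hemb.integral_map]
        refine integral_congr_ae ?_
        filter_upwards [coeFn_trace_testElement htr hψ] with x hx
        rw [hgS]
        change inner ℂ (tr (testElement O hψ) x) _ = _
        rw [hx]
        simp [mul_comm]
      have hint : Integrable (fun x => ψ x • g x) μ := by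
        refine (integrableOn_iff_integrable_of_support_subset (s := tsupport ψ) ?_).1
          ((hloc.integrableOn_compact_subset h3 h2).continuousOn_smul h1.continuous.continuousOn h2)
        exact (Function.support_smul_subset_left ψ g).trans (subset_tsupport ψ)
      rw [hμ, integrable_add_measure] at hint
      rw [hμ, integral_add_measure hint.1 hint.2, ← k3, ← k4]
      exact k2
  rw [hμ, ae_add_measure_iff] at hzero
  have z1 : h.fst = 0 := by
    refine Lp.ext ?_
    filter_upwards [hzero.1, hgO, ae_restrict_mem hO.measurableSet,
      Lp.coeFn_zero ℂ 2 (volume.restrict O)] with x k1 k2 k3 k4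
    rw [← k2, k1 (hOD k3), k4]; rfl
  have z2 : h.snd = 0 := by
    refine Lp.ext ?_
    have := (hemb.ae_map_iff).1 hzero.2
    filter_upwards [this, Lp.coeFn_zero ℂ 2 m] with x k1 k4
    rw [← hgS, k1 (hSD x.2), k4]; rfl
  change h = WithLp.toLp 2 (0, 0)
  rw [← z1, ← z2]
  rfl

end Density

/-! ### The elliptic form as a bounded operator on `V` -/

section Form

variable {A : E d → Matrix (Fin d) (Fin d) ℂ}

theorem norm_mulVec_le {B : Matrix (Fin d) (Fin d) ℂ} {Λ : ℝ} (hB : ∀ i k, ‖B i k‖ ≤ Λ) (ξ : F d) :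
    ‖(WithLp.toLp 2 (B *ᵥ ξ.ofLp) : F d)‖ ≤ (d * (d * Λ)) * ‖ξ‖ := by
  have hcoord : ∀ i, ‖(B *ᵥ ξ.ofLp) i‖ ≤ d * Λ * ‖ξ‖ := by
    intro i
    have e : (B *ᵥ ξ.ofLp) i = ∑ k, B i k * ξ k := rfl
    rw [e]
    refine (norm_sum_le _ _).trans ((Finset.sum_le_card_nsmul _ _ (Λ * ‖ξ‖) fun k _ => ?_).trans ?_)
    · rw [norm_mul]
      exact mul_le_mul (hB i k) (PiLp.norm_apply_le ξ k) (norm_nonneg _)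
        ((norm_nonneg _).trans (hB i k))
    · simp [mul_assoc]
  have hdec : (WithLp.toLp 2 (B *ᵥ ξ.ofLp) : F d) =
      ∑ i, EuclideanSpace.single i ((B *ᵥ ξ.ofLp) i) := by
    ext k
    simp [Finset.sum_apply, Pi.single_apply]
  rw [hdec]
  refine (norm_sum_le _ _).trans ((Finset.sum_le_card_nsmul _ _ (d * Λ * ‖ξ‖) fun k _ => ?_).trans ?_)
  · simpa using hcoord k
  · simp [mul_assoc]

theorem exists_memLp_mulVec (hA : IsElliptic O A) : ∃ C : ℝ, ∀ G : Lp (F d) 2 (volume.restrict O),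
    (MemLp (fun x => (WithLp.toLp 2 (A x *ᵥ (G x).ofLp) : F d)) 2 (volume.restrict O)) ∧
    ∀ᵐ x ∂volume.restrict O, ‖(WithLp.toLp 2 (A x *ᵥ (G x).ofLp) : F d)‖ ≤ C * ‖G x‖ := by
  obtain ⟨Λ, hΛ⟩ := hA.bounded
  refine ⟨d * (d * Λ), fun G => ?_⟩
  have hb : ∀ᵐ x ∂volume.restrict O,
      ‖(WithLp.toLp 2 (A x *ᵥ (G x).ofLp) : F d)‖ ≤ d * (d * Λ) * ‖G x‖ := by
    filter_upwards [hΛ] with x hx using norm_mulVec_le hx _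
  refine ⟨MemLp.of_le_mul (Lp.memLp G) ?_ hb, hb⟩
  refine (PiLp.continuous_toLp 2 _).comp_aestronglyMeasurable
    (aemeasurable_pi_iff.2 fun i => ?_).aestronglyMeasurable
  have e : (fun x => (A x *ᵥ (G x).ofLp) i) = fun x => ∑ k, A x i k * G x k := rfl
  rw [e]
  refine Finset.aemeasurable_fun_sum _ fun k _ => ?_
  exact (hA.measurable i k).mul
    ((EuclideanSpace.proj (𝕜 := ℂ) k).continuous.comp_aestronglyMeasurable
      (Lp.aestronglyMeasurable G)).aemeasurable

/-- Multiplication by the coefficient matrix as a bounded operator on `L²(O; ℂ^d)`. -/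
theorem exists_coefficientCLM (hA : IsElliptic O A) :
    ∃ M : Lp (F d) 2 (volume.restrict O) →L[ℂ] Lp (F d) 2 (volume.restrict O), ∀ G,
      (M G : E d → F d) =ᵐ[volume.restrict O] fun x => WithLp.toLp 2 (A x *ᵥ (G x).ofLp) := by
  obtain ⟨C, hC⟩ := exists_memLp_mulVec hA
  refine ⟨LinearMap.mkContinuous ⟨⟨fun G => (hC G).1.toLp _, fun G G' => ?_⟩, fun c G => ?_⟩ C
    fun G => ?_, fun G => (hC G).1.coeFn_toLp⟩
  · refine Lp.ext ?_
    filter_upwards [(hC (G + G')).1.coeFn_toLp, (hC G).1.coeFn_toLp, (hC G').1.coeFn_toLp,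
      Lp.coeFn_add G G', Lp.coeFn_add ((hC G).1.toLp _) ((hC G').1.toLp _)] with x h1 h2 h3 h4 h5
    rw [h1, h5, Pi.add_apply, h2, h3, h4, Pi.add_apply, WithLp.ofLp_add, Matrix.mulVec_add,
      WithLp.toLp_add]
  · refine Lp.ext ?_
    filter_upwards [(hC (c • G)).1.coeFn_toLp, (hC G).1.coeFn_toLp,
      Lp.coeFn_smul c G, Lp.coeFn_smul c ((hC G).1.toLp _)] with x h1 h2 h4 h5
    simp only [RingHom.id_apply]
    rw [h1, h5, Pi.smul_apply, h2, h4, Pi.smul_apply, WithLp.ofLp_smul, Matrix.mulVec_smul,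
      WithLp.toLp_smul]
  · refine Lp.norm_le_mul_norm_of_ae_le_mul ?_
    filter_upwards [(hC G).1.coeFn_toLp, (hC G).2] with x h1 h2
    simp only [LinearMap.coe_mk, AddHom.coe_mk]
    rw [h1]
    exact h2

/-- Ellipticity for vectors of arbitrary length. -/
theorem mul_norm_sq_le_re_inner {B : Matrix (Fin d) (Fin d) ℂ} {l : ℝ}
    (hB : ∀ ξ : F d, ‖ξ‖ = 1 → l ≤ (∑ i, (B *ᵥ ξ.ofLp) i * star (ξ i)).re) (ξ : F d) :
    l * ‖ξ‖ ^ 2 ≤ (inner ℂ ξ (WithLp.toLp 2 (B *ᵥ ξ.ofLp) : F d)).re := by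
  rcases eq_or_ne ξ 0 with rfl | hξ
  · simp
  · have hn := norm_pos_iff.2 hξ
    set c : ℂ := ((‖ξ‖⁻¹ : ℝ) : ℂ) with hc
    have h1 := hB (c • ξ) (by
      rw [norm_smul, hc, Complex.norm_real, norm_inv, norm_norm, inv_mul_cancel₀ hn.ne'])
    have h2 : (∑ i, (B *ᵥ (c • ξ).ofLp) i * star ((c • ξ) i)) =
        c * (c * inner ℂ ξ (WithLp.toLp 2 (B *ᵥ ξ.ofLp) : F d)) := by
      have hcc : star c = c := Complex.conj_ofReal _
      rw [PiLp.inner_apply, Finset.mul_sum, Finset.mul_sum]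
      refine Finset.sum_congr rfl fun i _ => ?_
      simp only [WithLp.ofLp_smul, Matrix.mulVec_smul, Pi.smul_apply, smul_eq_mul, star_mul', hcc,
        RCLike.inner_apply, starRingEnd_apply]
      ring
    rw [h2, hc, Complex.re_ofReal_mul, Complex.re_ofReal_mul] at h1
    have h4 := mul_le_mul_of_nonneg_right h1 (sq_nonneg ‖ξ‖)
    refine h4.trans_eq ?_
    field_simp

/-- The pullback of a bounded sesquilinear form under a bounded operator is represented by a bounded
operator. -/
theorem exists_pullbackCLM {W X : Type*} [NormedAddCommGroup W] [InnerProductSpace ℂ W]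
    [CompleteSpace W] [NormedAddCommGroup X] [InnerProductSpace ℂ X] [CompleteSpace X]
    (ι : W →L[ℂ] X) (M : X →L[ℂ] X) :
    ∃ a : W →L[ℂ] W, ∀ w v, inner ℂ v (a w) = inner ℂ (ι v) (M (ι w)) :=
  ⟨ι.adjoint ∘L M ∘L ι, fun w v => ContinuousLinearMap.adjoint_inner_right ι v (M (ι w))⟩

theorem exists_mul_norm_sq_le_re_inner (hA : IsElliptic O A)
    {M : Lp (F d) 2 (volume.restrict O) → Lp (F d) 2 (volume.restrict O)}
    (hM : ∀ G, (M G : E d → F d) =ᵐ[volume.restrict O]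
      fun x => WithLp.toLp 2 (A x *ᵥ (G x).ofLp)) :
    ∃ l : ℝ, 0 < l ∧ ∀ G, l * ‖G‖ ^ 2 ≤ (inner ℂ G (M G)).re := by
  obtain ⟨l, hl, hell⟩ := hA.elliptic
  refine ⟨l, hl, fun G => ?_⟩
  rw [L2.inner_def, norm_sq_eq_integral, ← integral_const_mul]
  refine le_of_le_of_eq ?_ (integral_re (L2.integrable_inner (𝕜 := ℂ) G (M G)))
  refine integral_mono_ae (((Lp.memLp G).integrable_norm_pow two_ne_zero).const_mul l)
    (L2.integrable_inner (𝕜 := ℂ) G (M G)).re ?_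
  filter_upwards [hM G, hell] with x h1 h2
  rw [h1]
  exact mul_norm_sq_le_re_inner h2 _

theorem exists_gradPullbackCLM
    (M : Lp (F d) 2 (volume.restrict O) →L[ℂ] Lp (F d) 2 (volume.restrict O)) :
    ∃ a : V O D →L[ℂ] V O D, ∀ w v, inner ℂ v (a w) = inner ℂ v.1.snd (M w.1.snd) :=
  exists_pullbackCLM (WithLp.sndL 2 ℂ (Lp ℂ 2 (volume.restrict O))
    (Lp (F d) 2 (volume.restrict O)) ∘L (V O D).subtypeL) M

/-- The form is represented by a bounded operator, and it is accretive and elliptic. -/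
theorem exists_formCLM (hA : IsElliptic O A) : ∃ a : V O D →L[ℂ] V O D,
    (∀ w v, inner ℂ v (a w) = form A w v) ∧
    ∃ l : ℝ, 0 < l ∧ ∀ w : V O D, l * ‖w.1.snd‖ ^ 2 ≤ (inner ℂ w (a w)).re := by
  obtain ⟨M, hM⟩ := exists_coefficientCLM hA
  obtain ⟨l, hl, hell⟩ := exists_mul_norm_sq_le_re_inner hA hM
  refine (exists_gradPullbackCLM (D := D) M).imp fun a hι => ?_
  have h1 : ∀ w v, inner ℂ v (a w) = form A w v := fun w v => by
    rw [hι, L2.inner_def, form]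
    refine integral_congr_ae ?_
    filter_upwards [hM w.1.snd] with x hx
    rw [hx, PiLp.inner_apply]
    simp
  have h2 : ∀ w : V O D, l * ‖w.1.snd‖ ^ 2 ≤ (inner ℂ w (a w)).re := fun w => by
    rw [hι]
    exact hell w.1.snd
  exact ⟨h1, l, hl, h2⟩

end Form

/-! ### Lower semicontinuity and convexity of `u ↦ ∫ |u|^q` -/

section PowerFunctional

variable {α : Type*} [MeasurableSpace α] {μ : Measure α} {q : ℝ}

/-- An `L²`-convergent sequence has an almost everywhere convergent subsequence, to which Fatou's
lemma applies. -/
theorem lowerSemicontinuous_lintegral_rpow (q : ℝ) :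
    LowerSemicontinuous fun u : Lp ℂ 2 μ => ∫⁻ x, ‖u x‖ₑ ^ q ∂μ := by
  rw [lowerSemicontinuous_iff_isClosed_preimage]
  refine fun c => IsSeqClosed.isClosed fun f u hf hfu => ?_
  obtain ⟨ns, -, hns⟩ := (tendstoInMeasure_of_tendsto_Lp hfu).exists_seq_tendsto_ae
  have hcont : Continuous fun z : ℂ => ‖z‖ₑ ^ q :=
    (ENNReal.continuous_rpow_const).comp continuous_enorm
  have h1 : ∫⁻ x, ‖u x‖ₑ ^ q ∂μ = ∫⁻ x, liminf (fun n => ‖f (ns n) x‖ₑ ^ q) atTop ∂μ := by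
    refine lintegral_congr_ae ?_
    filter_upwards [hns] with x hx
    exact (((hcont.tendsto (u x)).comp hx).liminf_eq).symm
  have h2 : ∫⁻ x, ‖u x‖ₑ ^ q ∂μ ≤ liminf (fun n => ∫⁻ x, ‖f (ns n) x‖ₑ ^ q ∂μ) atTop := by
    rw [h1]
    refine lintegral_liminf_le' fun n => ?_
    exact hcont.measurable.comp_aemeasurable (Lp.aestronglyMeasurable _).aemeasurable
  refine h2.trans ?_
  refine (liminf_le_liminf (Eventually.of_forall fun n => hf (ns n))).trans ?_
  simp

theorem lintegral_rpow_convex (hq : 1 ≤ q) (u v : Lp ℂ 2 μ) {a b : ℝ} (ha : 0 ≤ a) (hb : 0 ≤ b)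
    (hab : a + b = 1) :
    ∫⁻ x, ‖((a : ℂ) • u + (b : ℂ) • v : Lp ℂ 2 μ) x‖ₑ ^ q ∂μ ≤
      ENNReal.ofReal a * ∫⁻ x, ‖u x‖ₑ ^ q ∂μ + ENNReal.ofReal b * ∫⁻ x, ‖v x‖ₑ ^ q ∂μ := by
  have hm : ∀ w : Lp ℂ 2 μ, AEMeasurable (fun x => ‖w x‖ₑ ^ q) μ := fun w =>
    (Lp.aestronglyMeasurable w).enorm.pow_const q
  rw [← lintegral_const_mul'' _ (hm u), ← lintegral_const_mul'' _ (hm v),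
    ← lintegral_add_left' ((hm u).const_mul _)]
  refine lintegral_mono_ae ?_
  filter_upwards [Lp.coeFn_add ((a : ℂ) • u) ((b : ℂ) • v), Lp.coeFn_smul (a : ℂ) u,
    Lp.coeFn_smul (b : ℂ) v] with x h1 h2 h3
  rw [h1, Pi.add_apply, h2, h3, Pi.smul_apply, Pi.smul_apply]
  have e : ∀ c : ℝ, 0 ≤ c → ∀ z : ℂ, ‖(c : ℂ) • z‖ₑ = ENNReal.ofReal c * ‖z‖ₑ := by
    intro c hc z
    rw [enorm_smul, ← ofReal_norm (c : ℂ), Complex.norm_real, Real.norm_of_nonneg hc]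
  calc ‖(a : ℂ) • u x + (b : ℂ) • v x‖ₑ ^ q
      ≤ (ENNReal.ofReal a * ‖u x‖ₑ + ENNReal.ofReal b * ‖v x‖ₑ) ^ q := by
        gcongr
        rw [← e a ha, ← e b hb]
        exact enorm_add_le _ _
    _ ≤ _ := ENNReal.rpow_arith_mean_le_arith_mean2_rpow _ _ _ _
        (by rw [← ENNReal.ofReal_add ha hb, hab, ENNReal.ofReal_one]) hq

end PowerFunctional

/-! ### The `𝕃^q`-norm on `𝕃²` and the splitting `w = w' + s v` -/

section Hybrid

variable {q : ℝ}

/-- The `q`-th power of the norm of `𝕃^q`. -/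
def hybridPower (q : ℝ) (f : HybridL2 O m) : ℝ≥0∞ :=
  (∫⁻ x in O, ‖f.fst x‖ₑ ^ q) + ∫⁻ x, ‖f.snd x‖ₑ ^ q ∂m

theorem hybridNorm_le_iff (hq : 0 < q) {f g : HybridL2 O m} :
    hybridNorm q f ≤ hybridNorm q g ↔ hybridPower q f ≤ hybridPower q g :=
  ENNReal.rpow_le_rpow_iff (one_div_pos.2 hq)

theorem hybridNorm_ne_top_iff (hq : 0 < q) {f : HybridL2 O m} :
    hybridNorm q f ≠ ⊤ ↔ hybridPower q f ≠ ⊤ := by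
  have : hybridNorm q f = hybridPower q f ^ (1 / q) := rfl
  rw [this, Ne, ENNReal.rpow_eq_top_iff_of_pos (one_div_pos.2 hq)]

theorem isClosed_hybridPower_le (q : ℝ) (c : ℝ≥0∞) :
    IsClosed {f : HybridL2 O m | hybridPower q f ≤ c} := by
  have h1 := (lowerSemicontinuous_lintegral_rpow (μ := volume.restrict O) q).comp
    (WithLp.fstL 2 ℂ (Lp ℂ 2 (volume.restrict O)) (Lp ℂ 2 m)).continuous
  have h2 := (lowerSemicontinuous_lintegral_rpow (μ := m) q).comp
    (WithLp.sndL 2 ℂ (Lp ℂ 2 (volume.restrict O)) (Lp ℂ 2 m)).continuous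
  exact lowerSemicontinuous_iff_isClosed_preimage.1 (h1.add h2) c

theorem hybridPower_convex (hq : 1 ≤ q) {c : ℝ≥0∞} {f g : HybridL2 O m} (hf : hybridPower q f ≤ c)
    (hg : hybridPower q g ≤ c) {a b : ℝ} (ha : 0 ≤ a) (hb : 0 ≤ b) (hab : a + b = 1) :
    hybridPower q ((a : ℂ) • f + (b : ℂ) • g) ≤ c := by
  calc hybridPower q ((a : ℂ) • f + (b : ℂ) • g)
      ≤ (ENNReal.ofReal a * (∫⁻ x in O, ‖f.fst x‖ₑ ^ q) +
          ENNReal.ofReal b * ∫⁻ x in O, ‖g.fst x‖ₑ ^ q) +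
        (ENNReal.ofReal a * (∫⁻ x, ‖f.snd x‖ₑ ^ q ∂m) +
          ENNReal.ofReal b * ∫⁻ x, ‖g.snd x‖ₑ ^ q ∂m) :=
        add_le_add (lintegral_rpow_convex hq f.fst g.fst ha hb hab)
          (lintegral_rpow_convex hq f.snd g.snd ha hb hab)
    _ = ENNReal.ofReal a * hybridPower q f + ENNReal.ofReal b * hybridPower q g := by
        rw [hybridPower, hybridPower]; ring
    _ ≤ ENNReal.ofReal a * c + ENNReal.ofReal b * c := by gcongr
    _ = c := by
        rw [← add_mul, ← ENNReal.ofReal_add ha hb, hab, ENNReal.ofReal_one, one_mul]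

namespace IsPower

variable {u v g : HybridL2 O m}

theorem hybridPower_ne_top (h : IsPower q u v) (hq : 2 ≤ q) : hybridPower q u ≠ ⊤ :=
  ENNReal.add_ne_top.2 ⟨lintegral_ne_top_of_power hq h.1, lintegral_ne_top_of_power hq h.2⟩

theorem re_inner_self (h : IsPower q u v) (hq : 2 ≤ q) :
    (inner ℂ v u).re = (hybridPower q u).toReal := by
  rw [hybridPower, ENNReal.toReal_add (lintegral_ne_top_of_power hq h.1)
    (lintegral_ne_top_of_power hq h.2), WithLp.prod_inner_apply, Complex.add_re]
  exact congrArg₂ (· + ·) (re_inner_power_self_eq hq h.1) (re_inner_power_self_eq hq h.2)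

theorem re_inner_le (h : IsPower q u v) (hq : 2 ≤ q) (hg : hybridPower q g ≠ ⊤) :
    (inner ℂ v g).re ≤
      1 / q * (hybridPower q g).toReal + (1 - 1 / q) * (hybridPower q u).toReal := by
  obtain ⟨hg1, hg2⟩ := ENNReal.add_ne_top.1 hg
  rw [hybridPower, hybridPower, ENNReal.toReal_add (lintegral_ne_top_of_power hq h.1)
    (lintegral_ne_top_of_power hq h.2), ENNReal.toReal_add hg1 hg2, WithLp.prod_inner_apply,
    Complex.add_re]
  have h1 := re_inner_power_le_add hq h.1 hg1
  have h2 := re_inner_power_le_add hq h.2 hg2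
  exact (add_le_add h1 h2).trans_eq (by ring)

end IsPower

/-- The semigroup generated by an m-accretive operator leaves a closed set invariant that is convex
and invariant under the resolvents. -/
theorem IsYosidaLimit.mem_of_convex {H : Type*} [NormedAddCommGroup H] [InnerProductSpace ℂ H]
    [CompleteSpace H] {J : ℝ → H →L[ℂ] H} {T : ℝ≥0 → H →L[ℂ] H} (hT : IsYosidaLimit J T)
    {K : Set H} (hK : ∀ f ∈ K, ∀ g ∈ K, ∀ a b : ℝ, 0 ≤ a → 0 ≤ b → a + b = 1 →
      (a : ℂ) • f + (b : ℂ) • g ∈ K)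
    (hKc : IsClosed K) (hJK : ∀ r, 0 < r → ∀ f ∈ K, J r f ∈ K) (t : ℝ≥0) {f : H} (hf : f ∈ K) :
    T t f ∈ K := by
  refine hT.mem (fun f hf g hg a b ha hb hab => ?_) hKc hJK t hf
  rw [← Complex.coe_smul, ← Complex.coe_smul]
  exact hK f hf g hg a b ha hb hab

/-- `j(V)` contains the resolvents of the monotone map `z ↦ |z|^{q-2} z`. -/
theorem exists_isPower_resolvent {tr : V O D →L[ℂ] Lp ℂ 2 m} (htr : IsTrace tr) (hq : 2 ≤ q)
    (w : V O D) : ∃ w' v : ℕ → V O D, ∃ s : ℕ → ℝ, (∀ n, 0 < s n) ∧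
      (∀ n, w = w' n + (s n : ℂ) • v n) ∧ (∀ n, IsPower q (j tr (w' n)) (j tr (v n))) ∧
      Tendsto (fun n => j tr (w' n)) atTop (𝓝 (j tr w)) := by
  have hp : 0 ≤ q - 2 := by linarith
  set s : ℕ → ℝ := fun n => 1 / ((n : ℝ) + 1) with hs
  have hs0 : ∀ n, 0 < s n := fun n => Nat.one_div_pos_of_nat
  choose Φ hΦ hΦl hΦ0 using fun n => exists_power_resolvent hp (hs0 n).le
  -- Applying `Φ n` to both components of `j(w)` stays in `j(V)`. The equation for `Φ n` reads `(z -
  -- Φ n z) / s n = |Φ n z|^{q-2} Φ n z`, so the scaled remainder is the required power and lies in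
  -- `j(V)` too.
  choose w' hw' using fun n => exists_j_eq_compLp htr (hΦl n) (hΦ0 n) w
  have hpow : ∀ n {α : Type} [MeasurableSpace α] {μ : Measure α} (f g g' : Lp ℂ 2 μ),
      g = (hΦl n).compLp (hΦ0 n) f → g' = ((s n : ℂ)⁻¹) • (f - g) →
      (g' : α → ℂ) =ᵐ[μ] fun x => ((‖g x‖ ^ (q - 2) : ℝ) : ℂ) * g x := by
    rintro n α _ μ f g g' rfl rfl
    filter_upwards [Lp.coeFn_smul ((s n : ℂ)⁻¹) (f - (hΦl n).compLp (hΦ0 n) f),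
      Lp.coeFn_sub f ((hΦl n).compLp (hΦ0 n) f), (hΦl n).coeFn_compLp (hΦ0 n) f] with x h1 h2 h3
    rw [h1, Pi.smul_apply, h2, Pi.sub_apply, h3, Function.comp_apply]
    have h4 := hΦ n (f x)
    have h5 : f x - Φ n (f x) = (s n * ‖Φ n (f x)‖ ^ (q - 2)) • Φ n (f x) := by
      nth_rewrite 1 [← h4]; abel
    have hsn : (s n : ℂ) ≠ 0 := Complex.ofReal_ne_zero.2 (hs0 n).ne'
    rw [h5, Complex.real_smul, smul_eq_mul, Complex.ofReal_mul, mul_assoc,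
      inv_mul_cancel_left₀ hsn]
  refine ⟨w', fun n => ((s n : ℂ)⁻¹) • (w - w' n), s, hs0, fun n => ?_, fun n => ⟨?_, ?_⟩, ?_⟩
  · have hsn : (s n : ℂ) ≠ 0 := Complex.ofReal_ne_zero.2 (hs0 n).ne'
    rw [smul_inv_smul₀ hsn, add_sub_cancel]
  · exact hpow n w.1.fst (w' n).1.fst _ (congrArg WithLp.fst (hw' n)) rfl
  · refine hpow n (tr w) (tr (w' n)) _ (congrArg WithLp.snd (hw' n)) ?_
    change tr (((s n : ℂ)⁻¹) • (w - w' n)) = _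
    rw [map_smul, map_sub]
  · have hlim : ∀ z, Tendsto (fun n => Φ n z) atTop (𝓝 (id z)) := fun z =>
      tendsto_power_resolvent hp (fun n => (hs0 n).le) tendsto_one_div_add_atTop_nhds_zero_nat
        fun n => hΦ n z
    have hid : ∀ {α : Type} [MeasurableSpace α] {μ : Measure α} (f : Lp ℂ 2 μ),
        (LipschitzWith.id (α := ℂ)).compLp rfl f = f := fun f =>
      Lp.ext ((LipschitzWith.id (α := ℂ)).coeFn_compLp rfl f)
    have h1 := tendsto_compLp hΦl hΦ0 LipschitzWith.id rfl hlim
      (tendsto_const_nhds (x := w.1.fst))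
    have h2 := tendsto_compLp hΦl hΦ0 LipschitzWith.id rfl hlim
      (tendsto_const_nhds (x := tr w))
    rw [hid] at h1 h2
    have h3 := ((WithLp.prodContinuousLinearEquiv 2 ℂ (Lp ℂ 2 (volume.restrict O))
      (Lp ℂ 2 m)).symm.continuous.tendsto _).comp (h1.prodMk_nhds h2)
    exact h3.congr fun n => (hw' n).symm

end Hybrid

/-! ### Ellipticity of the form and contractivity of the resolvents -/

section Main

variable {q : ℝ}
  {tr : V O D →L[ℂ] Lp ℂ 2 m} {A : E d → Matrix (Fin d) (Fin d) ℂ}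
  {a : V O D →L[ℂ] V O D} {J : ℝ → HybridL2 O m →L[ℂ] HybridL2 O m}

theorem opGraph_eq (ha : ∀ w v, inner ℂ v (a w) = form A w v) :
    opGraph tr A = (formRelation (jCLM tr) a : Set (HybridL2 O m × HybridL2 O m)) := by
  ext p
  constructor
  · rintro ⟨w, h1, h2⟩
    exact ⟨w, h1, fun v => (h2 v).trans (ha w v).symm⟩
  · rintro ⟨w, h1, h2⟩
    exact ⟨w, h1, fun v => (h2 v).trans (ha w v)⟩

theorem isEllipticForm_jCLM (hO : IsOpen O) (hD : IsClosed D) (hDO : D ⊆ frontier O)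
    (hS : S ⊆ closure O \ D) (hSmeas : MeasurableSet S) (hSnull : volume S = 0)
    (htr : IsTrace tr) {l : ℝ} (hl : 0 < l)
    (hell : ∀ w : V O D, l * ‖w.1.snd‖ ^ 2 ≤ (inner ℂ w (a w)).re) :
    IsEllipticForm (jCLM tr) a where
  injective := jCLM_injective hO tr
  denseRange := jCLM_denseRange hO hD hDO hS hSmeas hSnull htr
  accretive w := le_trans (by positivity) (hell w)
  elliptic := by
    -- The gradient part of the norm is controlled by `l`, the function part with constant `1` by
    -- `‖j(w)‖²`.
    refine ⟨min l 1, by positivity, fun w => ?_⟩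
    have h1 : ‖w‖ ^ 2 = ‖w.1.fst‖ ^ 2 + ‖w.1.snd‖ ^ 2 := WithLp.prod_norm_sq_eq_of_L2 w.1
    have h2 : ‖jCLM tr w‖ ^ 2 = ‖w.1.fst‖ ^ 2 + ‖tr w‖ ^ 2 :=
      WithLp.prod_norm_sq_eq_of_L2 (jCLM tr w)
    have h3 := mul_le_mul_of_nonneg_right (min_le_left l 1) (sq_nonneg ‖w.1.snd‖)
    have h4 := mul_le_mul_of_nonneg_right (min_le_right l 1) (sq_nonneg ‖w.1.fst‖)
    rw [h1, h2]
    linarith [hell w, sq_nonneg ‖tr w‖]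

/-- The resolvents are `𝕃^q`-contractive if the form is accretive with respect to `|u|^{q-2} u`. -/
theorem hybridPower_resolvent_le (hq : 2 ≤ q) (htr : IsTrace tr)
    (ha : IsEllipticForm (jCLM tr) a) (hJ : IsResolvent (formRelation (jCLM tr) a) J)
    (hacc : ∀ w v : V O D, IsPower q (j tr w) (j tr v) → 0 ≤ (inner ℂ v (a w)).re)
    {r : ℝ} (hr : 0 < r) (f : HybridL2 O m) : hybridPower q (J r f) ≤ hybridPower q f := by
  rcases eq_or_ne (hybridPower q f) ⊤ with hf | hf
  · rw [hf]; exact le_top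
  obtain ⟨w, hw1, hw2⟩ := hJ.mem r hr f
  simp only at hw1 hw2
  obtain ⟨w', v, s, hs, hsplit, hpow, hlim⟩ := exists_isPower_resolvent htr hq w
  rw [← hw1]
  refine (isClosed_hybridPower_le q _).mem_of_tendsto hlim
    (Eventually.of_forall fun n => ?_)
  have h3 : (hybridPower q (j tr (w' n))).toReal ≤ (inner ℂ (j tr (v n)) f).re := by
    rw [← (hpow n).re_inner_self hq]
    exact ha.re_inner_le_re_inner hr (hs n) (fun v => by rw [hw1]; exact hw2 v) (hsplit n)
      (hacc _ _ (hpow n))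
  have h4 := (hpow n).re_inner_le hq hf
  -- The Young term `(1 - 1/q) ‖j(w')‖_q^q` is absorbed on the left, which is legitimate because
  -- `j(w')` has finite `𝕃^q`-norm.
  have h5 : 1 / q * (hybridPower q (j tr (w' n))).toReal ≤ 1 / q * (hybridPower q f).toReal := by
    linarith
  have h6 := le_of_mul_le_mul_left h5 (one_div_pos.2 (by linarith))
  exact (ENNReal.toReal_le_toReal ((hpow n).hybridPower_ne_top hq) hf).1 h6

end Main

end DynBC

end

/-- The semigroup generated by `-𝓛^A` on `𝕃²` exists and is unique, and it is `𝕃^q`-contractive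
iff `Re a(u|_O, (|u|^{q-2}u)|_O) ≥ 0` for all `u ∈ j(V)` with `|u|^{q-2}u ∈ j(V)`. -/
theorem proposition4p5 (d : ℕ) (hd : 2 ≤ d) (O D S : Set (DynBC.E d))
    (hO : IsOpen O) (hOne : O.Nonempty)
    (hD : IsClosed D) (hDO : D ⊆ frontier O)
    (hS : S ⊆ closure O \ D) (hSne : S.Nonempty) (hSmeas : MeasurableSet S)
    (hSnull : volume S = 0)
    (m : Measure S) [m.Regular]
    (tr : DynBC.V O D →L[ℂ] Lp ℂ 2 m) (htr : DynBC.IsTrace tr)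
    (A : DynBC.E d → Matrix (Fin d) (Fin d) ℂ) (hA : DynBC.IsElliptic O A)
    (q : ℝ) (hq : 2 ≤ q) :
    (∃! T : ℝ≥0 → DynBC.HybridL2 O m →L[ℂ] DynBC.HybridL2 O m,
      DynBC.IsSemigroupOf (DynBC.opGraph tr A) T) ∧
    ∀ T : ℝ≥0 → DynBC.HybridL2 O m →L[ℂ] DynBC.HybridL2 O m,
      DynBC.IsSemigroupOf (DynBC.opGraph tr A) T →
      (DynBC.IsContractive q T ↔
        ∀ u : DynBC.HybridL2 O m, ∀ w v : DynBC.V O D,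
          DynBC.j tr w = u → DynBC.IsPower q u (DynBC.j tr v) →
          0 ≤ (DynBC.form A w v).re) := by
  refine Exists.elim (DynBC.exists_formCLM (D := D) hA) fun a h => ?_
  have ha := h.1
  obtain ⟨l, hl, hell⟩ := h.2
  have hform := DynBC.isEllipticForm_jCLM hO hD hDO hS hSmeas hSnull htr hl hell
  have hL := hform.isMAccretive
  rw [DynBC.opGraph_eq ha]
  obtain ⟨J, hJ⟩ := hL.exists_resolvent
  obtain ⟨T, hT⟩ := DynBC.exists_isYosidaLimit hL hJ
  have hTs := hT.isSemigroupOf hL hJ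
  have huniq : ∀ T' : ℝ≥0 → DynBC.HybridL2 O m →L[ℂ] DynBC.HybridL2 O m,
      DynBC.IsSemigroupOf (DynBC.formRelation (DynBC.jCLM tr) a :
        Set (DynBC.HybridL2 O m × DynBC.HybridL2 O m)) T' → T' = T :=
    fun T' hT' => hT'.unique hL hTs
  refine ⟨⟨T, hTs, huniq⟩, fun T' hT' => ?_⟩
  rw [huniq T' hT']
  have hq0 : 0 < q := by linarith
  constructor
  · rintro hc u w v rfl hpow
    rw [← ha]
    refine hform.re_inner_nonneg hJ fun r hr => ?_
    have hu := hpow.hybridPower_ne_top hq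
    -- In Young's inequality the weights `1/q` and `1 - 1/q` add up to `1`, so contractivity bounds
    -- the pairing by `‖j(w)‖_q^q`. This is its value at `t = 0`.
    have h1 : ∀ t, (inner ℂ (DynBC.j tr v) (T t (DynBC.j tr w))).re ≤
        (DynBC.hybridPower q (DynBC.j tr w)).toReal := by
      intro t
      have h2 := (DynBC.hybridNorm_le_iff hq0).1
        (hc t _ ((DynBC.hybridNorm_ne_top_iff hq0).2 hu))
      have h3 := ENNReal.toReal_mono hu h2
      have h4 := hpow.re_inner_le hq (ne_top_of_le_ne_top hu h2)
      have h5 := mul_le_mul_of_nonneg_left h3 (one_div_pos.2 hq0).le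
      linarith
    have h2 := hTs.re_inner_resolvent_le (hT.norm_le hJ) hJ h1 hr
    rw [inner_sub_right, Complex.sub_re]
    have h3 := hpow.re_inner_self hq
    exact sub_nonneg.2 (h2.trans_eq h3.symm)
  · intro hacc t f _
    rw [DynBC.hybridNorm_le_iff hq0]
    refine hT.mem_of_convex (K := {g | DynBC.hybridPower q g ≤ DynBC.hybridPower q f})
      (fun f hf g hg a b ha hb hab => DynBC.hybridPower_convex (by linarith) hf hg ha hb hab)
      (DynBC.isClosed_hybridPower_le q _) (fun r hr g hg => ?_) t (le_refl (DynBC.hybridPower q f))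
    refine (DynBC.hybridPower_resolvent_le hq htr hform hJ (fun w v hwv => ?_) hr g).trans hg
    rw [ha]
    exact hacc _ w v rfl hwv
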